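/- A time-oriented Lorentzian metric $g$ on the torus $\mathbb{T}^2=\mathbb{R}^2/\mathbb{Z}^2$ is called class A if it is totally vicious (every point lies on a piecewise smooth future directed timelike loop) and its Abelian cover $\mathbb{R}^2$, with the lifted metric, is globally hyperbolic (it is strongly causal and all sets $J^+(p)\cap J^-(q)$ are compact). A point $p$ is a timelike pole if no timelike geodesic $\gamma:[0,a)\to\mathbb{T}^2$ with $\gamma(0)=p$ contains a pair of conjugate points. Theorem. For every $\varepsilon$ with $0<\varepsilon<1$ there is a smooth $1$-periodic function $f:\mathbb{R}\to(0,\infty)$ such that the Lorentzian metric $g_f=-f(x)^2\,dt^2+dx^2$ on $\mathbb{R}^2$ with coordinates $(t,x)$, time-oriented by $\partial/\partial t$, descends to a non-flat class A metric on $\mathbb{T}^2=\mathbb{R}^2/\mathbb{Z}^2$ whose set of timelike poles is Borel measurable and has volume $\lambda$ satisfying $$(1-\varepsilon)\,\mathrm{Vol}(\mathbb{T}^2,g_f)\le\lambda\le\mathrm{Vol}(\mathbb{T}^2,g_f).$$ -/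

import Mathlib

open MeasureTheory Set Topology
open scoped ContDiff Matrix

noncomputable section

namespace Lorentz

/-- The coordinate plane `ℝ²`, which is also the model of every tangent space. -/
abbrev Plane : Type := Fin 2 → ℝ

/-- A field of bilinear forms on the plane, given by its coefficients `g i j`. -/
abbrev MetricField : Type := Plane → Matrix (Fin 2) (Fin 2) ℝ

/-- The number `g_p(v, w)`. -/
def inner2 (g : MetricField) (p v w : Plane) : ℝ := v ⬝ᵥ (g p *ᵥ w)

/-- The partial derivative `∂_i F` at `p`. -/
def partialD (i : Fin 2) (F : Plane → ℝ) (p : Plane) : ℝ := fderiv ℝ F p (Pi.single i 1)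

/-- The Christoffel symbol `Γ^k_{ij}` of the Levi-Civita connection of `g`. -/
def christoffel (g : MetricField) (k i j : Fin 2) (p : Plane) : ℝ :=
  (1 / 2) * ∑ l, (g p)⁻¹ k l *
    (partialD i (fun q => g q j l) p + partialD j (fun q => g q i l) p
      - partialD l (fun q => g q i j) p)

/-- The component `R^l_{kij}` of the Riemann tensor:
`R(∂_i, ∂_j) ∂_k = ∇_i ∇_j ∂_k - ∇_j ∇_i ∂_k = ∑ l, R^l_{kij} ∂_l`. -/
def riemann (g : MetricField) (l k i j : Fin 2) (p : Plane) : ℝ :=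
  partialD i (christoffel g l j k) p - partialD j (christoffel g l i k) p
    + ∑ m, (christoffel g l i m p * christoffel g m j k p
        - christoffel g l j m p * christoffel g m i k p)

/-- The vector with components `∑ i j, Γ^k_{ij} v^i w^j`. -/
def connectionTerm (g : MetricField) (p v w : Plane) : Plane :=
  fun k => ∑ i, ∑ j, christoffel g k i j p * v i * w j

/-- The vector `R(u, v) w`. -/
def curvatureTerm (g : MetricField) (p u v w : Plane) : Plane :=
  fun l => ∑ k, ∑ i, ∑ j, riemann g l k i j p * u i * v j * w k

/-- `c` is a geodesic of `g` on the interval `I`, with velocity `v`: `c' = v` and `∇_v v = 0`.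
(Smoothness of `c` on `I` follows from the equation.) -/
def IsGeodesicOn (g : MetricField) (I : Set ℝ) (c v : ℝ → Plane) : Prop :=
  ∀ τ ∈ I, HasDerivWithinAt c (v τ) I τ ∧
    HasDerivWithinAt v (-connectionTerm g (c τ) (v τ) (v τ)) I τ

/-- `J` is a Jacobi field on `I` along the geodesic `c` with velocity `v`: with `W = DJ/dτ` the
covariant derivative of `J` along `c`, the equation is `DW/dτ + R(J, v) v = 0`. -/
def IsJacobiFieldOn (g : MetricField) (I : Set ℝ) (c v J : ℝ → Plane) : Prop :=
  ∃ W : ℝ → Plane, ∀ τ ∈ I,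
    HasDerivWithinAt J (W τ - connectionTerm g (c τ) (v τ) (J τ)) I τ ∧
    HasDerivWithinAt W (-connectionTerm g (c τ) (v τ) (W τ)
      - curvatureTerm g (c τ) (J τ) (v τ) (v τ)) I τ

/-- The parameters `s ≠ s'` in `I` give conjugate points along the geodesic `c`: some Jacobi
field which is not identically zero vanishes at both. -/
def AreConjugateOn (g : MetricField) (I : Set ℝ) (c v : ℝ → Plane) (s s' : ℝ) : Prop :=
  s ∈ I ∧ s' ∈ I ∧ s ≠ s' ∧
    ∃ J : ℝ → Plane, IsJacobiFieldOn g I c v J ∧ (∃ τ ∈ I, J τ ≠ 0) ∧ J s = 0 ∧ J s' = 0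

/-- `v` is a future directed timelike vector at `p`, for the time orientation given by `X`. -/
def IsFutureTimelike (g : MetricField) (X : Plane → Plane) (p v : Plane) : Prop :=
  inner2 g p v v < 0 ∧ inner2 g p (X p) v < 0

/-- `v` is a future directed causal vector at `p`, for the time orientation given by `X`. -/
def IsFutureCausal (g : MetricField) (X : Plane → Plane) (p v : Plane) : Prop :=
  v ≠ 0 ∧ inner2 g p v v ≤ 0 ∧ inner2 g p (X p) v < 0

/-- There is a smooth future directed timelike curve segment from `p` to `q`. -/
def TimelikeSegment (g : MetricField) (X : Plane → Plane) (p q : Plane) : Prop :=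
  ∃ c : ℝ → Plane, ContDiffOn ℝ ∞ c (Icc 0 1) ∧ c 0 = p ∧ c 1 = q ∧
    ∀ s ∈ Icc (0 : ℝ) 1, IsFutureTimelike g X (c s) (derivWithin c (Icc 0 1) s)

/-- There is a smooth future directed causal curve segment from `p` to `q`. -/
def CausalSegment (g : MetricField) (X : Plane → Plane) (p q : Plane) : Prop :=
  ∃ c : ℝ → Plane, ContDiffOn ℝ ∞ c (Icc 0 1) ∧ c 0 = p ∧ c 1 = q ∧
    ∀ s ∈ Icc (0 : ℝ) 1, IsFutureCausal g X (c s) (derivWithin c (Icc 0 1) s)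

/-- The relation `p ≤ q`: either `p = q`, or a piecewise smooth future directed causal curve
(a finite concatenation of smooth segments) joins `p` to `q`. -/
def CausallyPrecedes (g : MetricField) (X : Plane → Plane) : Plane → Plane → Prop :=
  Relation.ReflTransGen (CausalSegment g X)

/-- A set is causally convex if a causal curve with endpoints in the set stays in the set. -/
def CausallyConvex (g : MetricField) (X : Plane → Plane) (U : Set Plane) : Prop :=
  ∀ p ∈ U, ∀ r ∈ U, ∀ q, CausallyPrecedes g X p q → CausallyPrecedes g X q r → q ∈ U

/-- Every point has arbitrarily small causally convex open neighbourhoods. -/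
def StronglyCausal (g : MetricField) (X : Plane → Plane) : Prop :=
  ∀ p : Plane, ∀ U ∈ 𝓝 p, ∃ V ⊆ U, IsOpen V ∧ p ∈ V ∧ CausallyConvex g X V

/-- Global hyperbolicity: strong causality and compactness of all sets `J⁺(p) ∩ J⁻(q)`. -/
def GloballyHyperbolic (g : MetricField) (X : Plane → Plane) : Prop :=
  StronglyCausal g X ∧
    ∀ p q : Plane, IsCompact {r | CausallyPrecedes g X p r ∧ CausallyPrecedes g X r q}

/-- The torus `ℝ² / ℤ²`. -/
abbrev Torus : Type := UnitAddTorus (Fin 2)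

/-- The covering map `π : ℝ² → ℝ² / ℤ²`. -/
def proj (p : Plane) : Torus := fun i => (p i : UnitAddCircle)

end Lorentz

open Lorentz

/-- A time oriented Lorentzian metric on the torus `ℝ² / ℤ²`. Tensor fields are given by their
components in the global frame induced by the coordinates of `ℝ²`; they are smooth exactly if
their lifts to `ℝ²` are. In dimension two, the signature is `(-, +)` exactly if `det < 0`. -/
structure LorentzianTorus where
  metric : Torus → Matrix (Fin 2) (Fin 2) ℝ
  timeField : Torus → Plane
  metric_smooth : ∀ i j, ContDiff ℝ ∞ (fun p : Plane => metric (proj p) i j)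
  metric_symm : ∀ q, (metric q).IsSymm
  metric_lorentzian : ∀ q, (metric q).det < 0
  timeField_smooth : ContDiff ℝ ∞ (fun p : Plane => timeField (proj p))
  timeField_timelike : ∀ q, timeField q ⬝ᵥ (metric q *ᵥ timeField q) < 0

namespace LorentzianTorus

variable (M : LorentzianTorus)

/-- The metric of the Abelian cover `ℝ²`. -/
def coverMetric : MetricField := fun p => M.metric (proj p)

/-- The time orientation of the Abelian cover `ℝ²`. -/
def coverTimeField : Plane → Plane := fun p => M.timeField (proj p)

/-- The curvature tensor vanishes everywhere. -/
def IsFlat : Prop := ∀ (l k i j : Fin 2) (p : Plane), riemann M.coverMetric l k i j p = 0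

/-- There is a smooth future directed timelike curve segment on the torus from `p` to `q`;
such a curve is the projection of one in the cover. -/
def TimelikeSegment (p q : Torus) : Prop :=
  ∃ p' q' : Plane, proj p' = p ∧ proj q' = q ∧
    Lorentz.TimelikeSegment M.coverMetric M.coverTimeField p' q'

/-- The relation `p ≪ q` on the torus: a piecewise smooth future directed timelike curve (a finite
concatenation of smooth segments) joins `p` to `q`. -/
def ChronologicallyPrecedes : Torus → Torus → Prop := Relation.TransGen M.TimelikeSegment

/-- Every point lies on a timelike loop. -/
def TotallyVicious : Prop := ∀ q : Torus, M.ChronologicallyPrecedes q q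

/-- Class A: totally vicious, with globally hyperbolic Abelian cover. -/
def IsClassA : Prop :=
  M.TotallyVicious ∧ GloballyHyperbolic M.coverMetric M.coverTimeField

/-- The set of timelike poles: the points `q` such that no timelike geodesic `[0, a) → ℝ² / ℤ²`
starting at `q` contains a pair of conjugate points. Geodesics of the torus, and Jacobi fields
along them, are the projections of those of the cover. -/
def timelikePoles : Set Torus :=
  {q | ∀ a > 0, ∀ c v : ℝ → Plane, proj (c 0) = q →
    IsGeodesicOn M.coverMetric (Ico 0 a) c v →
    (∀ τ ∈ Ico 0 a, inner2 M.coverMetric (c τ) (v τ) (v τ) < 0) →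
    ∀ s s' : ℝ, ¬ AreConjugateOn M.coverMetric (Ico 0 a) c v s s'}

/-- The volume measure `√|det g| dt dx` of the metric. -/
def vol : Measure Torus :=
  (volume : Measure Torus).withDensity fun q => ENNReal.ofReal (Real.sqrt |(M.metric q).det|)

end LorentzianTorus

end

/-! Along a geodesic of `-f² dt² + dx²` both `E = f² t'` and the squared speed are conserved, so `x`
obeys a Newton equation `x'' = -E² f' / f³`, a particle in a potential whose minima are the minima
of `f`. The warping function `wellProfile w` equals `1`, its maximum, outside narrow wells around
the integers, and the timelike poles are exactly the points where it equals `1`.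

A timelike geodesic starting at such a point either keeps `x' ≠ 0` forever or is a vertical line
along which the curvature vanishes. In both cases a Rolle argument with conserved quantities shows
that a Jacobi field with two zeros is zero (`not_areConjugateOn_of_max`).

Through a point inside a well passes a geodesic oscillating between `p` and `-p`. The component of
the Killing field `∂_t` orthogonal to the velocity is a Jacobi field vanishing at every turning
point, so consecutive turning points are conjugate (`exists_areConjugateOn_of_well`).

Class A holds because the `t`-circles are timelike loops and `F = ∫ dx / f` turns the causal
structure of the cover into that of the Minkowski plane (`causallyPrecedes_iff`). With `w = ε / 2`
the wells have coordinate area at most `ε`, which gives the volume bound. -/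

open scoped NNReal

/-! ### Connection, curvature, geodesic and Jacobi equations of a warped metric. -/

namespace Lorentz

/-- The warped product metric `-f(x)² dt² + dx²` in the coordinates `(t, x)`. -/
def warpedMetric (f : ℝ → ℝ) : MetricField := fun p => !![-(f (p 1)) ^ 2, 0; 0, 1]

lemma inner2_warpedMetric (f : ℝ → ℝ) (p v w : Plane) :
    inner2 (warpedMetric f) p v w = -(f (p 1)) ^ 2 * v 0 * w 0 + v 1 * w 1 := by
  simp [inner2, warpedMetric, dotProduct, Matrix.mulVec, Fin.sum_univ_two]
  ring

lemma partialD_comp_snd {h : ℝ → ℝ} {p : Plane} {h' : ℝ} (hh : HasDerivAt h h' (p 1)) :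
    partialD 0 (fun q => h (q 1)) p = 0 ∧ partialD 1 (fun q => h (q 1)) p = h' := by
  have h1 : HasFDerivAt (fun q : Plane => q 1)
      (ContinuousLinearMap.proj (R := ℝ) (φ := fun _ : Fin 2 => ℝ) 1) p :=
    (ContinuousLinearMap.proj (R := ℝ) (φ := fun _ : Fin 2 => ℝ) 1).hasFDerivAt
  have h2 := (hh.comp_hasFDerivAt p h1).fderiv
  have h3 : fderiv ℝ (fun q : Plane => h (q 1)) p
      = h' • ContinuousLinearMap.proj (R := ℝ) (φ := fun _ : Fin 2 => ℝ) 1 := h2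
  simp [partialD, h3]

lemma partialD_const (i : Fin 2) (a : ℝ) (p : Plane) : partialD i (fun _ => a) p = 0 := by
  simp [partialD]

lemma warpedMetric_inv {f : ℝ → ℝ} (hpos : ∀ x, 0 < f x) (p : Plane) :
    (warpedMetric f p)⁻¹ = !![-((f (p 1)) ^ 2)⁻¹, 0; 0, 1] := by
  apply Matrix.inv_eq_right_inv
  have := (hpos (p 1)).ne'
  ext i j
  fin_cases i <;> fin_cases j <;> simp [warpedMetric, this]

section
variable {f f' f'' : ℝ → ℝ} (hpos : ∀ x, 0 < f x) (hf : ∀ x, HasDerivAt f (f' x) x)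
  (hf' : ∀ x, HasDerivAt f' (f'' x) x)

include hpos hf

lemma christoffel_warpedMetric (k i j : Fin 2) (p : Plane) :
    christoffel (warpedMetric f) k i j p =
      if k = 0 then (if i = j then 0 else f' (p 1) / f (p 1))
      else if i = 0 ∧ j = 0 then f (p 1) * f' (p 1) else 0 := by
  have hd : HasDerivAt (fun x => -(f x) ^ 2) (-(2 * f (p 1) * f' (p 1))) (p 1) := by
    simpa using ((hf (p 1)).fun_pow 2).fun_neg
  obtain ⟨h0, h1⟩ := partialD_comp_snd (h := fun x => -(f x) ^ 2) hd
  have hne := (hpos (p 1)).ne'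
  simp only [christoffel, warpedMetric_inv hpos]
  fin_cases k <;> fin_cases i <;> fin_cases j <;>
    simp [warpedMetric, Fin.sum_univ_two, partialD_const, h0, h1]; all_goals field_simp

lemma connectionTerm_warpedMetric (p v w : Plane) :
    connectionTerm (warpedMetric f) p v w =
      ![f' (p 1) / f (p 1) * (v 0 * w 1 + v 1 * w 0), f (p 1) * f' (p 1) * v 0 * w 0] := by
  ext k
  fin_cases k <;>
    simp [connectionTerm, Fin.sum_univ_two, christoffel_warpedMetric hpos hf]
  ring

include hf'

lemma riemann_warpedMetric (l k i j : Fin 2) (p : Plane) :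
    riemann (warpedMetric f) l k i j p =
      (if i = j then 0 else if i = 0 then -1 else 1) *
        (if l = k then 0 else if l = 0 then f'' (p 1) / f (p 1) else f (p 1) * f'' (p 1)) := by
  have hne := (hpos (p 1)).ne'
  obtain ⟨h0, h1⟩ := partialD_comp_snd (h := fun x => f' x / f x)
    ((hf' (p 1)).div (hf (p 1)) hne)
  obtain ⟨h2, h3⟩ := partialD_comp_snd (h := fun x => f x * f' x)
    ((hf (p 1)).mul (hf' (p 1)))
  have hc : ∀ k i j, christoffel (warpedMetric f) k i j = fun p =>
      if k = 0 then (if i = j then 0 else f' (p 1) / f (p 1))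
      else if i = 0 ∧ j = 0 then f (p 1) * f' (p 1) else 0 :=
    fun k i j => funext fun p => christoffel_warpedMetric hpos hf k i j p
  simp only [riemann, hc]
  fin_cases l <;> fin_cases k <;> fin_cases i <;> fin_cases j <;>
    simp [Fin.sum_univ_two, partialD_const, h0, h1, h2, h3] <;> field_simp <;> ring

lemma curvatureTerm_warpedMetric (p u v w : Plane) :
    curvatureTerm (warpedMetric f) p u v w =
      ![-(u 0 * v 1 - u 1 * v 0) * (f'' (p 1) / f (p 1)) * w 1,
        -(u 0 * v 1 - u 1 * v 0) * (f (p 1) * f'' (p 1)) * w 0] := by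
  ext k
  fin_cases k <;>
    simp [curvatureTerm, Fin.sum_univ_two, riemann_warpedMetric hpos hf hf'] <;> ring

end

section
variable {f f' f'' : ℝ → ℝ} (hpos : ∀ x, 0 < f x) (hf : ∀ x, HasDerivAt f (f' x) x)
  (hf' : ∀ x, HasDerivAt f' (f'' x) x)

lemma hasDerivWithinAt_plane {c : ℝ → Plane} {u : Plane} {I : Set ℝ} {τ : ℝ} :
    HasDerivWithinAt c u I τ ↔ HasDerivWithinAt (fun s => c s 0) (u 0) I τ ∧
      HasDerivWithinAt (fun s => c s 1) (u 1) I τ := by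
  rw [hasDerivWithinAt_pi, Fin.forall_fin_two]

include hpos hf

lemma isGeodesicOn_warpedMetric {I : Set ℝ} {c v : ℝ → Plane} :
    IsGeodesicOn (warpedMetric f) I c v ↔ ∀ τ ∈ I,
      HasDerivWithinAt (fun s => c s 0) (v τ 0) I τ ∧
      HasDerivWithinAt (fun s => c s 1) (v τ 1) I τ ∧
      HasDerivWithinAt (fun s => v s 0) (-(2 * (f' (c τ 1) / f (c τ 1)) * v τ 0 * v τ 1)) I τ ∧
      HasDerivWithinAt (fun s => v s 1) (-(f (c τ 1) * f' (c τ 1) * v τ 0 * v τ 0)) I τ := by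
  refine forall₂_congr fun τ _ => ?_
  rw [hasDerivWithinAt_plane, hasDerivWithinAt_plane, connectionTerm_warpedMetric hpos hf, and_assoc]
  have : (2 * (f' (c τ 1) / f (c τ 1)) * v τ 0 * v τ 1)
    = f' (c τ 1) / f (c τ 1) * (v τ 0 * v τ 1 + v τ 1 * v τ 0) := by ring
  simp [this]

include hf'

lemma isJacobiFieldOn_warpedMetric {I : Set ℝ} {c v J : ℝ → Plane} :
    IsJacobiFieldOn (warpedMetric f) I c v J ↔ ∃ W : ℝ → Plane, ∀ τ ∈ I,
      HasDerivWithinAt (fun s => J s 0)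
        (W τ 0 - f' (c τ 1) / f (c τ 1) * (v τ 0 * J τ 1 + v τ 1 * J τ 0)) I τ ∧
      HasDerivWithinAt (fun s => J s 1) (W τ 1 - f (c τ 1) * f' (c τ 1) * v τ 0 * J τ 0) I τ ∧
      HasDerivWithinAt (fun s => W s 0)
        (-(f' (c τ 1) / f (c τ 1) * (v τ 0 * W τ 1 + v τ 1 * W τ 0)) +
          -((J τ 1 * v τ 0 - J τ 0 * v τ 1) * (f'' (c τ 1) / f (c τ 1)) * v τ 1)) I τ ∧
      HasDerivWithinAt (fun s => W s 1)
        (-(f (c τ 1) * f' (c τ 1) * v τ 0 * W τ 0) +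
          -((J τ 1 * v τ 0 - J τ 0 * v τ 1) * (f (c τ 1) * f'' (c τ 1)) * v τ 0)) I τ := by
  refine exists_congr fun W => forall₂_congr fun τ _ => ?_
  rw [hasDerivWithinAt_plane, hasDerivWithinAt_plane, connectionTerm_warpedMetric hpos hf,
    connectionTerm_warpedMetric hpos hf, curvatureTerm_warpedMetric hpos hf hf', and_assoc]
  simp [sub_eq_add_neg]

end

end Lorentz

/-! ### Newton's equation on the line and Rolle-type lemmas. -/

namespace Lorentz

section Newton

lemma eq_of_newton {h : ℝ → ℝ} {K : ℝ≥0} (hh : LipschitzWith K h) {x u y w : ℝ → ℝ} {a b : ℝ}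
    (hx : ∀ t ∈ Icc a b, HasDerivWithinAt x (u t) (Icc a b) t)
    (hu : ∀ t ∈ Icc a b, HasDerivWithinAt u (h (x t)) (Icc a b) t)
    (hy : ∀ t ∈ Icc a b, HasDerivWithinAt y (w t) (Icc a b) t)
    (hw : ∀ t ∈ Icc a b, HasDerivWithinAt w (h (y t)) (Icc a b) t)
    (hxy : x a = y a) (huw : u a = w a) :
    ∀ t ∈ Icc a b, x t = y t ∧ u t = w t := by
  have hV : LipschitzWith (max 1 (K * 1)) (fun z : ℝ × ℝ => (z.2, h z.1)) :=
    LipschitzWith.prod_snd.prodMk (hh.comp LipschitzWith.prod_fst)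
  have hc : ∀ {x u : ℝ → ℝ}, (∀ t ∈ Icc a b, HasDerivWithinAt x (u t) (Icc a b) t) →
      (∀ t ∈ Icc a b, HasDerivWithinAt u (h (x t)) (Icc a b) t) →
      ∀ t ∈ Icc a b, HasDerivWithinAt (fun t => (x t, u t)) (u t, h (x t)) (Icc a b) t :=
    fun hx hu t ht => (hx t ht).prodMk (hu t ht)
  have hI : ∀ t ∈ Ico a b, Icc a b ∈ 𝓝[≥] t := fun t ht => Icc_mem_nhdsGE_of_mem ht
  have := ODE_solution_unique_of_mem_Icc_right (v := fun _ (z : ℝ × ℝ) => (z.2, h z.1))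
    (s := fun _ => univ) (fun t _ => hV.lipschitzOnWith)
    (fun t ht => (hc hx hu t ht).continuousWithinAt)
    (fun t ht => (hc hx hu t (Ico_subset_Icc_self ht)).mono_of_mem_nhdsWithin (hI t ht))
    (fun _ _ => mem_univ _)
    (fun t ht => (hc hy hw t ht).continuousWithinAt)
    (fun t ht => (hc hy hw t (Ico_subset_Icc_self ht)).mono_of_mem_nhdsWithin (hI t ht))
    (fun _ _ => mem_univ _) (Prod.ext hxy huw)
  exact fun t ht => Prod.ext_iff.1 (this ht)

lemma exists_newton {h : ℝ → ℝ} {K : ℝ≥0} (hh : LipschitzWith K h) {H : ℝ}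
    (hH : ∀ x, |h x| ≤ H) (x₀ : ℝ) {T : ℝ} (hT : 0 < T) :
    ∃ x u : ℝ → ℝ, x 0 = x₀ ∧ u 0 = 0 ∧
      (∀ t ∈ Icc 0 T, HasDerivWithinAt x (u t) (Icc 0 T) t) ∧
      ∀ t ∈ Icc 0 T, HasDerivWithinAt u (h (x t)) (Icc 0 T) t := by
  lift T to ℝ≥0 using hT.le
  lift H to ℝ≥0 using (abs_nonneg _).trans (hH 0)
  have hT0 : T ≠ 0 := by rintro rfl; simp at hT
  have hV : LipschitzWith (max (T⁻¹ * 1) (T * (K * 1)))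
      (fun z : ℝ × ℝ => ((T : ℝ)⁻¹ * z.2, (T : ℝ) * h z.1)) := by
    refine LipschitzWith.prodMk ?_ ?_
    · refine LipschitzWith.comp (g := Prod.snd) (f := fun y : ℝ => (T : ℝ)⁻¹ * y) ?_
        LipschitzWith.prod_snd
      exact (lipschitzWith_smul (β := ℝ) (T : ℝ)⁻¹).weaken (by simp)
    · refine LipschitzWith.comp (g := fun z : ℝ × ℝ => h z.1) (f := fun y : ℝ => (T : ℝ) * y) ?_
        (hh.comp LipschitzWith.prod_fst)
      exact (lipschitzWith_smul (β := ℝ) (T : ℝ)).weaken (by simp)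
  -- The second coordinate is `T` times the velocity. On the ball of radius `T² H` both components
  -- of the rescaled field are then at most `T H`, exactly what is needed to solve on all of `[0,
  -- T]` at once.
  have hP : IsPicardLindelof (fun _ (z : ℝ × ℝ) => ((T : ℝ)⁻¹ * z.2, (T : ℝ) * h z.1))
      (tmin := 0) (tmax := T) ⟨0, le_rfl, T.2⟩ (x₀, 0) (T * T * H) 0 (T * H)
      (max (T⁻¹ * 1) (T * (K * 1))) := by
    refine ⟨fun _ _ => hV.lipschitzOnWith, fun _ _ => continuousOn_const, ?_, ?_⟩
    · intro t _ z hz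
      rw [Metric.mem_closedBall, Prod.dist_eq, max_le_iff] at hz
      rw [Prod.norm_def]
      refine max_le ?_ ?_
      · have := hz.2
        simp only [Real.dist_eq, sub_zero] at this
        simp only [norm_mul, norm_inv, Real.norm_eq_abs, NNReal.abs_eq]
        rw [inv_mul_le_iff₀ hT]
        refine this.trans (le_of_eq ?_)
        push_cast; ring
      · simp only [norm_mul, Real.norm_eq_abs, NNReal.abs_eq]
        push_cast
        exact mul_le_mul_of_nonneg_left (hH _) T.2
    · simp
      exact le_of_eq (by ring)
  obtain ⟨α, h0, hα⟩ := hP.exists_eq_forall_mem_Icc_hasDerivWithinAt₀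
  have h0 : α 0 = (x₀, 0) := h0
  refine ⟨fun t => (α t).1, fun t => (T : ℝ)⁻¹ * (α t).2, by simp [h0], by simp [h0], ?_, ?_⟩
  · intro t ht
    exact (hasFDerivAt_fst (𝕜 := ℝ) (E := ℝ) (F := ℝ)).comp_hasDerivWithinAt t (hα t ht)
  · intro t ht
    have := ((hasFDerivAt_snd (𝕜 := ℝ) (E := ℝ) (F := ℝ)).comp_hasDerivWithinAt t
      (hα t ht)).const_mul (T : ℝ)⁻¹
    have hT' : (T : ℝ) ≠ 0 := hT.ne'
    simpa [hT'] using this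

end Newton

lemma eq_of_hasDerivWithinAt_zero {g g' : ℝ → ℝ} {I : Set ℝ} (hI : Convex ℝ I)
    (hg : ∀ t ∈ I, HasDerivWithinAt g (g' t) I t) (hg' : ∀ t ∈ I, g' t = 0) {s t : ℝ} (hs : s ∈ I)
    (ht : t ∈ I) : g t = g s := by
  have := hI.norm_image_sub_le_of_norm_hasDerivWithin_le (C := 0) hg
    (fun t ht => by simp [hg' t ht]) hs ht
  simpa [sub_eq_zero] using this

lemma exists_deriv_eq_zero_of_convex {g g' : ℝ → ℝ} {I : Set ℝ} (hI : Convex ℝ I)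
    (hg : ∀ t ∈ I, HasDerivWithinAt g (g' t) I t) {s t : ℝ} (hs : s ∈ I) (ht : t ∈ I)
    (hst : s < t) (h : g s = g t) : ∃ r ∈ I, g' r = 0 := by
  have hsub : Icc s t ⊆ I := hI.ordConnected.out hs ht
  obtain ⟨r, hr, h0⟩ := exists_hasDerivAt_eq_zero (f := g) (f' := g') hst
    (fun r hr => (hg r (hsub hr)).continuousWithinAt.mono hsub) h
    (fun r hr => (hg r (hsub (Ioo_subset_Icc_self hr))).hasDerivAt
      (Filter.mem_of_superset (Icc_mem_nhds hr.1 hr.2) hsub))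
  exact ⟨r, hsub (Ioo_subset_Icc_self hr), h0⟩

/-- A function whose derivative is `k • ρ` with `ρ` nowhere zero and which vanishes twice is zero. -/
lemma eq_zero_of_deriv_eq_mul {g ρ : ℝ → ℝ} {k : ℝ} {I : Set ℝ} (hI : Convex ℝ I)
    (hg : ∀ t ∈ I, HasDerivWithinAt g (k * ρ t) I t) (hρ : ∀ t ∈ I, ρ t ≠ 0) {s s' : ℝ}
    (hs : s ∈ I) (hs' : s' ∈ I) (hss : s ≠ s') (h0 : g s = 0) (h0' : g s' = 0) :
    k = 0 ∧ ∀ t ∈ I, g t = 0 := by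
  have hk : k = 0 := by
    have : ∃ r ∈ I, k * ρ r = 0 := by
      rcases lt_or_gt_of_ne hss with h | h
      · exact exists_deriv_eq_zero_of_convex hI hg hs hs' h (by rw [h0, h0'])
      · exact exists_deriv_eq_zero_of_convex hI hg hs' hs h (by rw [h0, h0'])
    obtain ⟨r, hr, h⟩ := this
    exact (mul_eq_zero.1 h).resolve_right (hρ r hr)
  refine ⟨hk, fun t ht => ?_⟩
  rw [eq_of_hasDerivWithinAt_zero hI hg (fun t _ => by simp [hk]) hs ht, h0]

end Lorentz

/-! ### Geodesics issuing from a maximum of the warping function. -/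

namespace Lorentz

section
variable {f f' f'' : ℝ → ℝ} (hpos : ∀ x, 0 < f x) (hf : ∀ x, HasDerivAt f (f' x) x)
  (hf' : ∀ x, HasDerivAt f' (f'' x) x)

include hpos hf

/-- The energy `f² dt/dτ` of a geodesic is conserved. -/
lemma energy_eq {I : Set ℝ} (hI : Convex ℝ I) {c v : ℝ → Plane}
    (hgeo : IsGeodesicOn (warpedMetric f) I c v) {s t : ℝ} (hs : s ∈ I) (ht : t ∈ I) :
    f (c t 1) ^ 2 * v t 0 = f (c s 1) ^ 2 * v s 0 := by
  rw [isGeodesicOn_warpedMetric hpos hf] at hgeo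
  refine eq_of_hasDerivWithinAt_zero hI (g := fun t => f (c t 1) ^ 2 * v t 0)
    (fun t ht => (((hf _).comp_hasDerivWithinAt t (hgeo t ht).2.1).pow 2).mul (hgeo t ht).2.2.1)
    (fun t _ => ?_) hs ht
  have := (hpos (c t 1)).ne'
  simp
  field_simp
  ring

/-- The speed of a geodesic is conserved. -/
lemma speed_eq {I : Set ℝ} (hI : Convex ℝ I) {c v : ℝ → Plane}
    (hgeo : IsGeodesicOn (warpedMetric f) I c v) {s t : ℝ} (hs : s ∈ I) (ht : t ∈ I) :
    v t 1 ^ 2 - f (c t 1) ^ 2 * v t 0 ^ 2 = v s 1 ^ 2 - f (c s 1) ^ 2 * v s 0 ^ 2 := by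
  rw [isGeodesicOn_warpedMetric hpos hf] at hgeo
  refine eq_of_hasDerivWithinAt_zero hI (g := fun t => v t 1 ^ 2 - f (c t 1) ^ 2 * v t 0 ^ 2)
    (fun t ht => ((hgeo t ht).2.2.2.pow 2).sub
      ((((hf _).comp_hasDerivWithinAt t (hgeo t ht).2.1).pow 2).mul ((hgeo t ht).2.2.1.pow 2)))
    (fun t _ => ?_) hs ht
  have := (hpos (c t 1)).ne'
  simp
  field_simp
  ring

/-- A geodesic which starts at a maximum of the warping function either stays there or is
transversal to the fibres at all times. -/
lemma snd_velocity_ne_zero_or_eq {K : ℝ → ℝ≥0}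
    (hlip : ∀ E, LipschitzWith (K E) (fun x => -(E ^ 2 * f' x / f x ^ 3))) {a : ℝ} {c v : ℝ → Plane}
    (hgeo : IsGeodesicOn (warpedMetric f) (Ico 0 a) c v)
    (hmax : ∀ x, f x ≤ f (c 0 1)) :
    (∀ τ ∈ Ico 0 a, v τ 1 ≠ 0) ∨ ∀ τ ∈ Ico 0 a, c τ 1 = c 0 1 ∧ v τ 1 = 0 := by
  rcases le_or_gt a 0 with ha | ha
  · left; intro τ hτ; linarith [hτ.1, hτ.2]
  have h0 : (0 : ℝ) ∈ Ico 0 a := ⟨le_rfl, ha⟩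
  have hI : Convex ℝ (Ico 0 a) := convex_Ico 0 a
  by_cases hv : v 0 1 = 0
  · right
    have hE := fun τ (hτ : τ ∈ Ico 0 a) => energy_eq hpos hf hI hgeo h0 hτ
    rw [isGeodesicOn_warpedMetric hpos hf] at hgeo
    set E := f (c 0 1) ^ 2 * v 0 0
    have hcrit : f' (c 0 1) = 0 :=
      IsLocalMax.hasDerivAt_eq_zero (Filter.Eventually.of_forall hmax) (hf _)
    intro τ hτ
    have hsub : Icc 0 τ ⊆ Ico 0 a := fun s hs => ⟨hs.1, hs.2.trans_lt hτ.2⟩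
    -- A maximum is an equilibrium of the Newton equation, so a solution at rest there is constant
    -- by uniqueness.
    refine eq_of_newton (hlip E) (x := fun s => c s 1) (u := fun s => v s 1)
      (y := fun _ => c 0 1) (w := fun _ => 0) (a := 0) (b := τ)
      (fun t ht => (hgeo t (hsub ht)).2.1.mono hsub)
      (fun t ht => ?_) (fun t _ => hasDerivWithinAt_const _ _ _)
      (fun t _ => ?_) rfl hv τ ⟨hτ.1, le_rfl⟩
    · refine ((hgeo t (hsub ht)).2.2.2.mono hsub).congr_deriv ?_
      rw [← hE t (hsub ht)]
      have := (hpos (c t 1)).ne'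
      field_simp
    · simpa [hcrit] using hasDerivWithinAt_const t (Icc 0 τ) (0 : ℝ)
  · left
    intro τ hτ h
    have hE := energy_eq hpos hf hI hgeo h0 hτ
    have hM := speed_eq hpos hf hI hgeo h0 hτ
    have h1 := hpos (c τ 1)
    have h2 := hmax (c τ 1)
    -- If `x'` vanished at `τ`, conservation of speed would make `f² t'²` drop strictly below its
    -- initial value. As `f²` does not exceed its initial value either, the product `E² = f² · f²
    -- t'²` would drop, against conservation of `E`.
    have h3 : f (c τ 1) ^ 2 * v τ 0 ^ 2 < f (c 0 1) ^ 2 * v 0 0 ^ 2 := by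
      have : 0 < v 0 1 ^ 2 := by positivity
      rw [h] at hM
      linarith
    have h4 : f (c τ 1) ^ 2 ≤ f (c 0 1) ^ 2 := by gcongr
    have h5 : f (c τ 1) ^ 2 * (f (c τ 1) ^ 2 * v τ 0 ^ 2)
        = f (c 0 1) ^ 2 * (f (c 0 1) ^ 2 * v 0 0 ^ 2) := by
      linear_combination (f (c τ 1) ^ 2 * v τ 0 + f (c 0 1) ^ 2 * v 0 0) * hE
    have h6 : 0 < f (c 0 1) ^ 2 := by have := hpos (c 0 1); positivity
    have h7 : 0 ≤ f (c τ 1) ^ 2 * v τ 0 ^ 2 := by positivity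
    nlinarith

include hf'

/-- A timelike geodesic starting at a maximum of the warping function where the second derivative
vanishes has no conjugate points. -/
theorem not_areConjugateOn_of_max {K : ℝ → ℝ≥0}
    (hlip : ∀ E, LipschitzWith (K E) (fun x => -(E ^ 2 * f' x / f x ^ 3))) {a : ℝ} {c v : ℝ → Plane}
    (hgeo : IsGeodesicOn (warpedMetric f) (Ico 0 a) c v)
    (htl : ∀ τ ∈ Ico 0 a, inner2 (warpedMetric f) (c τ) (v τ) (v τ) < 0)
    (hmax : ∀ x, f x ≤ f (c 0 1)) (hflat : f'' (c 0 1) = 0) (s s' : ℝ) :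
    ¬ AreConjugateOn (warpedMetric f) (Ico 0 a) c v s s' := by
  rintro ⟨hs, hs', hss, J, hJ, ⟨τ₀, hτ₀, hJne⟩, hJs, hJs'⟩
  have hI : Convex ℝ (Ico 0 a) := convex_Ico 0 a
  have hv0 : ∀ τ ∈ Ico 0 a, v τ 0 ≠ 0 := by
    intro τ hτ h
    have := htl τ hτ
    rw [inner2_warpedMetric, h] at this
    nlinarith [sq_nonneg (v τ 1)]
  have halt := snd_velocity_ne_zero_or_eq hpos hf hlip hgeo hmax
  have hcrit : f' (c 0 1) = 0 :=
      IsLocalMax.hasDerivAt_eq_zero (Filter.Eventually.of_forall hmax) (hf _)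
  rw [isGeodesicOn_warpedMetric hpos hf] at hgeo
  obtain ⟨W, hW⟩ := (isJacobiFieldOn_warpedMetric hpos hf hf').1 hJ
  have hJs0 : J s 0 = 0 := by simp [hJs]
  have hJs1 : J s 1 = 0 := by simp [hJs]
  have hJs0' : J s' 0 = 0 := by simp [hJs']
  have hJs1' : J s' 1 = 0 := by simp [hJs']
  have hfc := fun t (ht : t ∈ Ico 0 a) => (hf _).comp_hasDerivWithinAt t (hgeo t ht).2.1
  have hfc' := fun t (ht : t ∈ Ico 0 a) => (hf' _).comp_hasDerivWithinAt t (hgeo t ht).2.1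
  apply hJne
  -- conservation of `g(DJ, v)`
  have hk : ∀ t ∈ Ico 0 a, W t 1 * v t 1 - f (c t 1) ^ 2 * (W t 0 * v t 0)
      = W s 1 * v s 1 - f (c s 1) ^ 2 * (W s 0 * v s 0) := fun t ht =>
    eq_of_hasDerivWithinAt_zero hI
      (g := fun t => W t 1 * v t 1 - f (c t 1) ^ 2 * (W t 0 * v t 0))
      (fun t ht => ((hW t ht).2.2.2.mul (hgeo t ht).2.2.2).sub
        (((hfc t ht).pow 2).mul ((hW t ht).2.2.1.mul (hgeo t ht).2.2.1)))
      (fun t _ => by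
        have := (hpos (c t 1)).ne'
        simp
        field_simp
        ring) hs ht
  -- conservation of the first variation of the energy
  have he : ∀ t ∈ Ico 0 a, f (c t 1) ^ 2 * W t 0
        + f (c t 1) * f' (c t 1) * (v t 0 * J t 1 - v t 1 * J t 0)
      = f (c s 1) ^ 2 * W s 0
        + f (c s 1) * f' (c s 1) * (v s 0 * J s 1 - v s 1 * J s 0) := fun t ht =>
    eq_of_hasDerivWithinAt_zero hI
      (g := fun t => f (c t 1) ^ 2 * W t 0
        + f (c t 1) * f' (c t 1) * (v t 0 * J t 1 - v t 1 * J t 0))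
      (fun t ht => (((hfc t ht).pow 2).mul (hW t ht).2.2.1).add
        (((hfc t ht).mul (hfc' t ht)).mul
          (((hgeo t ht).2.2.1.mul (hW t ht).2.1).sub ((hgeo t ht).2.2.2.mul (hW t ht).1))))
      (fun t _ => by
        have := (hpos (c t 1)).ne'
        simp
        field_simp
        ring) hs ht
  set k := W s 1 * v s 1 - f (c s 1) ^ 2 * (W s 0 * v s 0)
  set e := f (c s 1) ^ 2 * W s 0 + f (c s 1) * f' (c s 1) * (v s 0 * J s 1 - v s 1 * J s 0)
  -- The function `g(J, v)` has constant derivative `k = g(DJ, v)` and vanishes twice, so `k = 0`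
  -- and `J` is orthogonal to `v`.
  obtain ⟨hk0, hort⟩ := eq_zero_of_deriv_eq_mul hI (k := k) (ρ := fun _ => 1)
    (g := fun t => J t 1 * v t 1 - f (c t 1) ^ 2 * (J t 0 * v t 0))
    (fun t ht => by
      refine HasDerivWithinAt.congr_deriv (((hW t ht).2.1.mul (hgeo t ht).2.2.2).sub
        (((hfc t ht).pow 2).mul ((hW t ht).1.mul (hgeo t ht).2.2.1))) ?_
      rw [← hk t ht]
      have := (hpos (c t 1)).ne'
      simp
      field_simp
      ring)
    (fun _ _ => one_ne_zero) hs hs' hss (by simp [hJs0, hJs1]) (by simp [hJs0', hJs1'])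
  rcases halt with hv1 | hv1
  -- Transversal case: with `k = 0` the quotient `J¹ / v¹` has derivative `e · v⁰ / (v¹)²`, whose
  -- second factor never vanishes. Two zeros force `J¹ = 0`, and orthogonality then gives `J⁰ = 0`.
  · obtain ⟨-, hJ1⟩ := eq_zero_of_deriv_eq_mul hI (k := e) (ρ := fun t => v t 0 / v t 1 ^ 2)
      (g := fun t => J t 1 / v t 1)
      (fun t ht => by
        have h1 := hv1 t ht
        refine ((hW t ht).2.1.div (hgeo t ht).2.2.2 h1).congr_deriv ?_
        have hkt := hk t ht
        rw [hk0] at hkt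
        rw [← he t ht]
        field_simp
        linear_combination hkt)
      (fun t ht => div_ne_zero (hv0 t ht) (pow_ne_zero _ (hv1 t ht))) hs hs' hss
      (by simp [hJs1]) (by simp [hJs1'])
    have h1 : J τ₀ 1 = 0 := by
      have := hJ1 τ₀ hτ₀
      simpa [hv1 τ₀ hτ₀] using this
    have h0 : J τ₀ 0 = 0 := by
      have := hort τ₀ hτ₀
      simpa [h1, hv0 τ₀ hτ₀, (hpos (c τ₀ 1)).ne'] using this
    ext i; fin_cases i <;> simp [h0, h1]
  -- Vertical case: orthogonality gives `J⁰ = 0`, and since `f'` and `f''` vanish along the line,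
  -- `J¹` is affine.
  · have hc : ∀ t ∈ Ico 0 a, c t 1 = c 0 1 := fun t ht => (hv1 t ht).1
    have hJ0 : ∀ t ∈ Ico 0 a, J t 0 = 0 := by
      intro t ht
      have := hort t ht
      simpa [(hv1 t ht).2, hv0 t ht, (hpos (c t 1)).ne'] using this
    have hW1 : ∀ t ∈ Ico 0 a, W t 1 = W s 1 := fun t ht =>
      eq_of_hasDerivWithinAt_zero hI (g := fun t => W t 1) (fun t ht => (hW t ht).2.2.2)
        (fun t ht => by simp [hc t ht, hcrit, hflat]) hs ht
    obtain ⟨-, hJ1⟩ := eq_zero_of_deriv_eq_mul hI (k := W s 1) (ρ := fun _ => 1)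
      (g := fun t => J t 1)
      (fun t ht => by
        refine (hW t ht).2.1.congr_deriv ?_
        simp [hc t ht, hcrit, hW1 t ht])
      (fun _ _ => one_ne_zero) hs hs' hss hJs1 hJs1'
    have h1 := hJ1 τ₀ hτ₀
    have h0 := hJ0 τ₀ hτ₀
    ext i; fin_cases i <;> simp [h0, h1]

end

end Lorentz

/-! ### Causal structure and global hyperbolicity of the cover. -/

namespace Lorentz

/-- The coordinate `∫ dx / f` in which the warped metric is conformally flat. -/
lemma exists_conformal_coordinate {f : ℝ → ℝ} (hfs : ContDiff ℝ ∞ f) (hpos : ∀ x, 0 < f x)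
    (hle : ∀ x, f x ≤ 1) : ∃ F : ℝ ≃ₜ ℝ, ContDiff ℝ ∞ F.symm ∧
      (∀ x, HasDerivAt F (f x)⁻¹ x) ∧ ∀ x y, |x - y| ≤ |F x - F y| := by
  have hinv : ContDiff ℝ ∞ (fun x => (f x)⁻¹) := hfs.inv fun x => (hpos x).ne'
  set F : ℝ → ℝ := fun x => ∫ t in (0 : ℝ)..x, (f t)⁻¹ with hF
  have hd : ∀ x, HasDerivAt F (f x)⁻¹ x := fun x =>
    intervalIntegral.integral_hasDerivAt_right (hinv.continuous.intervalIntegrable _ _)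
      (hinv.continuous.stronglyMeasurableAtFilter _ _) hinv.continuous.continuousAt
  have hFs : ContDiff ℝ ∞ F := by
    rw [show (∞ : WithTop ℕ∞) = ∞ + 1 from rfl, contDiff_succ_iff_deriv]
    refine ⟨fun x => (hd x).differentiableAt, by simp, ?_⟩
    rwa [funext fun x => (hd x).deriv]
  -- From `f ≤ 1` one has `F' ≥ 1`. This yields surjectivity of `F` as well as the expansion
  -- estimate.
  have hmono : Monotone (fun x => F x - x) := by
    refine monotone_of_deriv_nonneg (fun x => ((hd x).sub (hasDerivAt_id x)).differentiableAt) ?_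
    intro x
    rw [((hd x).fun_sub (hasDerivAt_id' x)).deriv, sub_nonneg]
    exact (one_le_inv₀ (hpos x)).2 (hle x)
  have hstrict : StrictMono F := fun x y hxy => by
    have := hmono hxy.le
    simp only at this
    linarith
  have hF0 : F 0 = 0 := by simp [hF]
  have hsurj : Function.Surjective F := by
    refine hFs.continuous.surjective ?_ ?_
    · refine Filter.tendsto_atTop_mono' _ ?_ Filter.tendsto_id
      filter_upwards [Filter.eventually_ge_atTop 0] with x hx
      have := hmono hx
      simp only [hF0] at this
      simp; linarith
    · refine Filter.tendsto_atBot_mono' _ ?_ Filter.tendsto_id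
      filter_upwards [Filter.eventually_le_atBot 0] with x hx
      have := hmono hx
      simp only [hF0] at this
      simp; linarith
  let e := (hstrict.orderIsoOfSurjective F hsurj).toHomeomorph
  have he : ∀ x, e x = F x := fun _ => rfl
  have hexp : ∀ x y, x ≤ y → |x - y| ≤ |F x - F y| := fun x y hxy => by
    have h1 := hmono hxy
    have h2 := hstrict.monotone hxy
    simp only at h1
    rw [abs_of_nonpos (by linarith), abs_of_nonpos (by linarith)]
    linarith
  refine ⟨e, e.contDiff_symm_deriv (f' := fun x => (f x)⁻¹) (fun x => inv_ne_zero (hpos x).ne')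
    hd hFs, hd, fun x y => ?_⟩
  rcases le_total x y with h | h
  · exact hexp x y h
  · rw [abs_sub_comm, abs_sub_comm (e x)]; exact hexp y x h

section
variable {f : ℝ → ℝ} (hpos : ∀ x, 0 < f x) {F : ℝ ≃ₜ ℝ} (hF : ∀ x, HasDerivAt F (f x)⁻¹ x)
include hpos hF

/-- The null coordinates `t + F(x)` and `t - F(x)` are nondecreasing along future causal curves;
they are the cases `σ = ±1` below. -/
lemma CausalSegment.abs_sub_le {p q : Plane}
    (h : CausalSegment (warpedMetric f) (fun _ => ![1, 0]) p q) :
    |F (q 1) - F (p 1)| ≤ q 0 - p 0 := by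
  obtain ⟨c, hc, rfl, rfl, hcaus⟩ := h
  have hd : ∀ s ∈ Icc (0 : ℝ) 1, HasDerivWithinAt c (derivWithin c (Icc 0 1) s) (Icc 0 1) s :=
    fun s hs => (hc.differentiableOn (by simp) s hs).hasDerivWithinAt
  have hmono : ∀ σ : ℝ, |σ| ≤ 1 → MonotoneOn (fun s => c s 0 + σ * F (c s 1)) (Icc 0 1) := by
    intro σ hσ
    have hD : ∀ s ∈ Icc (0 : ℝ) 1, HasDerivWithinAt (fun s => c s 0 + σ * F (c s 1))
        (derivWithin c (Icc 0 1) s 0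
          + σ * ((f (c s 1))⁻¹ * derivWithin c (Icc 0 1) s 1)) (Icc 0 1) s := fun s hs => by
      obtain ⟨h0, h1⟩ := hasDerivWithinAt_plane.1 (hd s hs)
      exact h0.add (((hF _).comp_hasDerivWithinAt s h1).const_mul σ)
    refine monotoneOn_of_hasDerivWithinAt_nonneg (convex_Icc 0 1)
      (fun s hs => (hD s hs).continuousWithinAt)
      (fun s hs => (hD s (interior_subset hs)).mono interior_subset) fun s hs => ?_
    obtain ⟨-, h1, h2⟩ := hcaus s (interior_subset hs)
    set u := derivWithin c (Icc 0 1) s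
    rw [inner2_warpedMetric] at h1 h2
    have hf := hpos (c s 1)
    simp at h2
    have hu0 : 0 < u 0 := by
      by_contra hcon
      nlinarith [pow_pos hf 2]
    have habs : |u 1| ≤ f (c s 1) * u 0 := by
      refine abs_le_of_sq_le_sq ?_ (by positivity)
      nlinarith
    have h3 : |σ * ((f (c s 1))⁻¹ * u 1)| ≤ u 0 := by
      rw [abs_mul, abs_mul, abs_of_pos (inv_pos.2 hf)]
      have : (f (c s 1))⁻¹ * |u 1| ≤ u 0 := by rwa [inv_mul_le_iff₀ hf]
      calc |σ| * ((f (c s 1))⁻¹ * |u 1|) ≤ 1 * ((f (c s 1))⁻¹ * |u 1|) := by gcongr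
        _ ≤ u 0 := by rwa [one_mul]
    linarith [neg_abs_le (σ * ((f (c s 1))⁻¹ * u 1))]
  have h0 : (0 : ℝ) ∈ Icc (0 : ℝ) 1 := by simp
  have h1 : (1 : ℝ) ∈ Icc (0 : ℝ) 1 := by simp
  have hp := hmono 1 (by simp) h0 h1 zero_le_one
  have hm := hmono (-1) (by simp) h0 h1 zero_le_one
  simp only at hp hm
  rw [abs_le]
  constructor <;> linarith

/-- In the conformal coordinate, the causal relation is that of the Minkowski plane. -/
lemma causallyPrecedes_iff (hFs : ContDiff ℝ ∞ F.symm) {p q : Plane} :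
    CausallyPrecedes (warpedMetric f) (fun _ => ![1, 0]) p q ↔
      |F (q 1) - F (p 1)| ≤ q 0 - p 0 := by
  constructor
  · intro h
    induction h with
    | refl => simp
    | tail _ hbc ih =>
      have h1 := hbc.abs_sub_le hpos hF
      rw [abs_le] at *
      constructor <;> linarith [ih.1, ih.2, h1.1, h1.2]
  · intro h
    rcases eq_or_ne p q with rfl | hne
    · exact Relation.ReflTransGen.refl
    have ht : 0 < q 0 - p 0 := by
      refine ((abs_nonneg _).trans h).lt_of_ne fun h0 => hne ?_
      rw [← h0, abs_nonpos_iff, sub_eq_zero] at h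
      ext i
      fin_cases i
      · simp; linarith
      · simpa using F.injective h.symm
    refine Relation.ReflTransGen.single ?_
    have hG : ∀ y, HasDerivAt F.symm (f (F.symm y)) y := fun y => by
      have := HasDerivAt.of_local_left_inverse F.symm.continuous.continuousAt (hF (F.symm y))
        (inv_ne_zero (hpos _).ne') (Filter.Eventually.of_forall fun z => F.apply_symm_apply z)
      rwa [inv_inv] at this
    -- The straight segment in the coordinates `(t, F(x))`.
    set c : ℝ → Plane := fun s =>
      ![p 0 + s * (q 0 - p 0), F.symm (F (p 1) + s * (F (q 1) - F (p 1)))] with hc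
    have hcd : ∀ s, HasDerivAt c ![q 0 - p 0, f (c s 1) * (F (q 1) - F (p 1))] s := by
      intro s
      rw [hasDerivAt_pi, Fin.forall_fin_two]
      constructor
      · simpa [hc] using ((hasDerivAt_id s).mul_const (q 0 - p 0)).const_add (p 0)
      · simpa [hc, Function.comp_def] using (hG _).comp s
          (((hasDerivAt_id s).mul_const (F (q 1) - F (p 1))).const_add (F (p 1)))
    refine ⟨c, ?_, ?_, ?_, fun s hs => ?_⟩
    · refine ContDiff.contDiffOn (contDiff_pi.2 (Fin.forall_fin_two.2 ⟨?_, ?_⟩))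
      · simp only [hc, Matrix.cons_val_zero]; fun_prop
      · simp only [hc, Matrix.cons_val_one]
        exact hFs.comp (by fun_prop)
    · ext i; fin_cases i <;> simp [hc]
    · ext i; fin_cases i <;> simp [hc]
    · rw [(hcd s).hasDerivWithinAt.derivWithin (uniqueDiffOn_Icc zero_lt_one s hs)]
      have hf := hpos (c s 1)
      refine ⟨fun h0 => ht.ne' (by simpa using congrFun h0 0), ?_, ?_⟩
      · rw [inner2_warpedMetric]
        have : (F (q 1) - F (p 1)) ^ 2 ≤ (q 0 - p 0) ^ 2 := sq_le_sq' (by linarith [abs_le.1 h]) (le_of_abs_le h)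
        simp
        nlinarith [pow_pos hf 2]
      · rw [inner2_warpedMetric]
        simp
        positivity

/-- A warped metric with warping function at most one is globally hyperbolic. -/
theorem globallyHyperbolic_of_conformal (hFs : ContDiff ℝ ∞ F.symm)
    (hexp : ∀ x y, |x - y| ≤ |F x - F y|) :
    GloballyHyperbolic (warpedMetric f) (fun _ => ![1, 0]) := by
  have hcone : ∀ {p q}, CausallyPrecedes (warpedMetric f) (fun _ => ![1, 0]) p q →
      |q 1 - p 1| ≤ q 0 - p 0 := fun h =>
    (hexp _ _).trans ((causallyPrecedes_iff hpos hF hFs).1 h)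
  constructor
  · intro p U hU
    obtain ⟨δ, hδ, hball⟩ := Metric.mem_nhds_iff.1 hU
    -- Since `F` is expanding, the causal cones lie inside the Minkowski cones of `(t, x)`, for
    -- which these open diamonds are causally convex.
    refine ⟨{r | |r 0 - p 0| + |r 1 - p 1| < δ}, fun r hr => hball ?_, ?_, by simpa using hδ, ?_⟩
    · rw [Metric.mem_ball, dist_pi_lt_iff hδ, Fin.forall_fin_two]
      simp only [mem_ofPred_eq, Real.dist_eq] at *
      constructor <;> linarith [abs_nonneg (r 0 - p 0), abs_nonneg (r 1 - p 1)]
    · exact isOpen_lt (by fun_prop) continuous_const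
    · intro a ha b hb q haq hqb
      have h1 := abs_le.1 (hcone haq)
      have h2 := abs_le.1 (hcone hqb)
      simp only [mem_ofPred_eq] at *
      have h3 := le_abs_self (b 0 - p 0)
      have h4 := abs_le.1 (le_refl |b 1 - p 1|)
      have h5 := neg_abs_le (a 0 - p 0)
      have h6 := abs_le.1 (le_refl |a 1 - p 1|)
      rcases abs_cases (q 0 - p 0) with h | h <;> rcases abs_cases (q 1 - p 1) with h' | h' <;>
        linarith [h1.1, h1.2, h2.1, h2.2, h4.1, h4.2, h6.1, h6.2]
  · intro p q
    have hset : {r | CausallyPrecedes (warpedMetric f) (fun _ => ![1, 0]) p r ∧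
        CausallyPrecedes (warpedMetric f) (fun _ => ![1, 0]) r q} =
        {r | |F (r 1) - F (p 1)| ≤ r 0 - p 0} ∩ {r | |F (q 1) - F (r 1)| ≤ q 0 - r 0} := by
      ext r
      simp [causallyPrecedes_iff hpos hF hFs]
    refine Metric.isCompact_of_isClosed_isBounded ?_ ?_
    · rw [hset]
      have := F.continuous
      exact (isClosed_le (by fun_prop) (by fun_prop)).inter
        (isClosed_le (by fun_prop) (by fun_prop))
    · refine (Metric.isBounded_closedBall (x := p) (r := |q 0 - p 0|)).subset fun r hr => ?_
      have h1 := hcone hr.1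
      have h2 := hcone hr.2
      have h3 := abs_nonneg (r 1 - p 1)
      have h4 := abs_nonneg (q 1 - r 1)
      have h5 := le_abs_self (q 0 - p 0)
      rw [Metric.mem_closedBall, dist_pi_le_iff (abs_nonneg _), Fin.forall_fin_two]
      simp only [Real.dist_eq]
      constructor
      · rw [abs_of_nonneg (by linarith)]; linarith
      · linarith

end

end Lorentz

/-! ### Oscillating geodesics and conjugate points inside a well. -/

namespace Lorentz

lemma exists_antideriv_on_Icc {g : ℝ → ℝ} {a b : ℝ} (hab : a ≤ b) (hg : ContinuousOn g (Icc a b))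
    (y : ℝ) : ∃ G : ℝ → ℝ, G a = y ∧ ∀ t ∈ Icc a b, HasDerivWithinAt G (g t) (Icc a b) t := by
  have hc : Continuous (IccExtend hab ((Icc a b).domRestrict g)) :=
    (continuousOn_iff_continuous_domRestrict.1 hg).Icc_extend'
  refine ⟨fun t => y + ∫ r in a..t, IccExtend hab ((Icc a b).domRestrict g) r, by simp, fun t ht => ?_⟩
  have := (intervalIntegral.integral_hasDerivAt_right (hc.intervalIntegrable a t)
    (hc.stronglyMeasurableAtFilter _ _) hc.continuousAt).const_add y
  rw [IccExtend_of_mem hab _ ht] at this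
  exact this.hasDerivWithinAt

section
variable {f f' f'' : ℝ → ℝ} (hpos : ∀ x, 0 < f x) (hf : ∀ x, HasDerivAt f (f' x) x)

include hpos hf

lemma newton_energy {E T : ℝ} {x u : ℝ → ℝ}
    (hx : ∀ t ∈ Icc 0 T, HasDerivWithinAt x (u t) (Icc 0 T) t)
    (hu : ∀ t ∈ Icc 0 T, HasDerivWithinAt u (-(E ^ 2 * f' (x t) / f (x t) ^ 3)) (Icc 0 T) t)
    {t : ℝ} (ht : t ∈ Icc 0 T) :
    u t ^ 2 - E ^ 2 / f (x t) ^ 2 = u 0 ^ 2 - E ^ 2 / f (x 0) ^ 2 := by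
  refine eq_of_hasDerivWithinAt_zero (convex_Icc 0 T) (g := fun t => u t ^ 2 - E ^ 2 / f (x t) ^ 2)
    (fun t ht => ((hu t ht).pow 2).sub ((hasDerivWithinAt_const t _ (E ^ 2)).div
      (((hf _).comp_hasDerivWithinAt t (hx t ht)).pow 2)
      (pow_ne_zero _ (hpos _).ne'))) (fun t _ => ?_) ⟨le_rfl, ht.1.trans ht.2⟩ ht
  have := (hpos (x t)).ne'
  simp
  field_simp
  ring

/-- A particle released at rest inside the well reaches its centre in bounded time. -/
lemma exists_time_reaching_center (hf'c : Continuous f') {w p : ℝ} (hp : 0 < p) (hpw : p < w)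
    (hwell : ∀ x ∈ Ioo 0 w, 0 < f' x) :
    ∃ T₀ > 0, ∀ T ≥ T₀, ∀ x u : ℝ → ℝ, x 0 = p → u 0 = 0 →
      (∀ t ∈ Icc 0 T, HasDerivWithinAt x (u t) (Icc 0 T) t) →
      (∀ t ∈ Icc 0 T, HasDerivWithinAt u (-(f p ^ 2 * f' (x t) / f (x t) ^ 3)) (Icc 0 T) t) →
      ∃ τ ∈ Icc 0 T₀, x τ = 0 := by
  have hfc : Continuous f := continuous_iff_continuousAt.2 fun x => (hf x).continuousAt
  set h : ℝ → ℝ := fun y => f p ^ 2 * f' y / f y ^ 3 with hh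
  have hhc : Continuous h :=
    (continuous_const.mul hf'c).div (hfc.pow 3) fun y => pow_ne_zero _ (hpos y).ne'
  have hhpos : ∀ y ∈ Ioo 0 w, 0 < h y := fun y hy => by
    have := hwell y hy
    have := hpos y
    have := hpos p
    simp only [hh]; positivity
  obtain ⟨y₀, hy₀, hmin⟩ := isCompact_Icc.exists_isMinOn (s := Icc (p / 2) p)
    ⟨p, by linarith, le_rfl⟩ hhc.continuousOn
  set η := h y₀
  have hη : 0 < η := hhpos y₀ ⟨by linarith [hy₀.1], by linarith [hy₀.2]⟩
  have hmono : StrictMonoOn f (Ico 0 w) := by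
    refine strictMonoOn_of_deriv_pos (convex_Ico 0 w) hfc.continuousOn fun y hy => ?_
    rw [interior_Ico] at hy
    rw [(hf y).deriv]
    exact hwell y hy
  -- `η` is the least force on `[p / 2, p]`. If the centre were not reached by `T₀`, then `x` would
  -- be positive and concave, hence at least `p / 2` on `[0, T₀ / 2]`. The force there gives `x ≤ p
  -- - η t² / 2`, which is negative at `T₀ / 2` once `η T₀² > 8 p`.
  refine ⟨8 * p / η + 1, by positivity, fun T hT x u hx0 hu0 hx hu => ?_⟩
  set T₀ := 8 * p / η + 1 with hT₀
  have hT₀1 : 1 ≤ T₀ := by rw [hT₀]; have : 0 < 8 * p / η := by positivity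
                           linarith
  have hT₀p : 8 * p < η * T₀ ^ 2 := by
    have h1 : 8 * p < η * T₀ := by
      rw [hT₀, mul_add, mul_div_cancel₀ _ hη.ne']; linarith
    nlinarith
  by_contra! hne
  have hsub : Icc 0 T₀ ⊆ Icc 0 T := Icc_subset_Icc_right hT
  have hxc : ContinuousOn x (Icc 0 T₀) := fun t ht => (hx t (hsub ht)).continuousWithinAt.mono hsub
  have hxpos : ∀ t ∈ Icc 0 T₀, 0 < x t := by
    intro t ht
    by_contra! hle
    obtain ⟨r, hr, hr0⟩ := intermediate_value_Icc' ht.1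
      (hxc.mono (Icc_subset_Icc_right ht.2)) (show (0 : ℝ) ∈ Icc (x t) (x 0) from ⟨hle, by linarith⟩)
    exact hne r ⟨hr.1, hr.2.trans ht.2⟩ hr0
  -- Energy conservation forces `f(x) ≤ f(p)`, so the values just above `p`, where `f` is larger,
  -- are unattainable.
  have hxle : ∀ t ∈ Icc 0 T₀, x t ≤ p := by
    intro t ht
    by_contra! hlt
    obtain ⟨y, hy1, hy2⟩ := exists_between (lt_min hlt hpw)
    obtain ⟨r, hr, hry⟩ := intermediate_value_Icc ht.1
      (hxc.mono (Icc_subset_Icc_right ht.2))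
      (show y ∈ Icc (x 0) (x t) from ⟨by linarith, (hy2.trans_le (min_le_left _ _)).le⟩)
    have hen := newton_energy hpos hf hx hu (hsub ⟨hr.1, hr.2.trans ht.2⟩)
    have hlt : f p < f y := hmono ⟨hp.le, hpw⟩
      ⟨by linarith, hy2.trans_le (min_le_right _ _)⟩ hy1
    have hpp := hpos p
    rw [hry, hx0, hu0, div_self (by positivity)] at hen
    have : f p ^ 2 / f y ^ 2 < 1 := by
      rw [div_lt_one (by have := hpos y; positivity)]
      gcongr
    nlinarith [sq_nonneg (u r)]
  have hhx : ∀ t ∈ Icc 0 T₀, 0 < h (x t) := fun t ht =>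
    hhpos _ ⟨hxpos t ht, (hxle t ht).trans_lt hpw⟩
  have hd : ∀ t ∈ interior (Icc 0 T₀), HasDerivAt x (u t) t ∧ HasDerivAt u (-(h (x t))) t := by
    intro t ht
    have hnhds : Icc 0 T ∈ 𝓝 t := Filter.mem_of_superset
      (mem_interior_iff_mem_nhds.1 ht) hsub
    have ht' := hsub (interior_subset ht)
    exact ⟨(hx t ht').hasDerivAt hnhds, (hu t ht').hasDerivAt hnhds⟩
  have huc : ContinuousOn u (Icc 0 T₀) := fun t ht => (hu t (hsub ht)).continuousWithinAt.mono hsub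
  have huanti : AntitoneOn u (Icc 0 T₀) :=
    antitoneOn_of_deriv_nonpos (convex_Icc _ _) huc
      (fun t ht => (hd t ht).2.differentiableAt.differentiableWithinAt)
      fun t ht => by rw [(hd t ht).2.deriv]; linarith [hhx t (interior_subset ht)]
  have hconc : ConcaveOn ℝ (Icc 0 T₀) x := by
    refine AntitoneOn.concaveOn_of_deriv (convex_Icc _ _) hxc
      (fun t ht => (hd t ht).1.differentiableAt.differentiableWithinAt) ?_
    intro s hs t ht hst
    rw [(hd s hs).1.deriv, (hd t ht).1.deriv]
    exact huanti (interior_subset hs) (interior_subset ht) hst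
  have hT₀pos : 0 < T₀ := by linarith
  have hhalf : ∀ t ∈ Icc 0 (T₀ / 2), p / 2 ≤ x t := by
    intro t ht
    have h1 : t / T₀ ≤ 1 / 2 := by rw [div_le_iff₀ hT₀pos]; linarith [ht.2]
    have h0 : 0 ≤ t / T₀ := div_nonneg ht.1 hT₀pos.le
    have := hconc.2 (show (0 : ℝ) ∈ Icc 0 T₀ from ⟨le_rfl, hT₀pos.le⟩)
      (show T₀ ∈ Icc 0 T₀ from ⟨hT₀pos.le, le_rfl⟩)
      (show 0 ≤ 1 - t / T₀ by linarith) h0 (by ring)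
    simp only [smul_eq_mul, mul_zero, zero_add, div_mul_cancel₀ _ hT₀pos.ne', hx0] at this
    nlinarith [hxpos T₀ ⟨hT₀pos.le, le_rfl⟩]
  have hsub2 : Icc 0 (T₀ / 2) ⊆ Icc 0 T₀ := Icc_subset_Icc_right (by linarith)
  have hhη : ∀ t ∈ Icc 0 (T₀ / 2), η ≤ h (x t) := fun t ht =>
    hmin ⟨hhalf t ht, hxle t (hsub2 ht)⟩
  have hd2 : ∀ t ∈ interior (Icc 0 (T₀ / 2)), t ∈ interior (Icc 0 T₀) :=
    fun t ht => interior_mono hsub2 ht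
  have hg1 : AntitoneOn (fun t => u t + η * t) (Icc 0 (T₀ / 2)) :=
    antitoneOn_of_deriv_nonpos (convex_Icc _ _) ((huc.mono hsub2).add (by fun_prop))
      (fun t ht => ((hd t (hd2 t ht)).2.add
        ((hasDerivAt_id t).const_mul η)).differentiableAt.differentiableWithinAt)
      fun t ht => by
        rw [((hd t (hd2 t ht)).2.fun_add ((hasDerivAt_id' t).const_mul η)).deriv]
        linarith [hhη t (interior_subset ht)]
  have hule : ∀ t ∈ Icc 0 (T₀ / 2), u t + η * t ≤ 0 := fun t ht => by
    have := hg1 ⟨le_rfl, by linarith⟩ ht ht.1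
    simpa [hu0] using this
  have hg2 : AntitoneOn (fun t => x t + η / 2 * t ^ 2) (Icc 0 (T₀ / 2)) :=
    antitoneOn_of_deriv_nonpos (convex_Icc _ _) ((hxc.mono hsub2).add (by fun_prop))
      (fun t ht => ((hd t (hd2 t ht)).1.add
        ((hasDerivAt_pow 2 t).const_mul (η / 2))).differentiableAt.differentiableWithinAt)
      fun t ht => by
        rw [((hd t (hd2 t ht)).1.fun_add ((hasDerivAt_pow 2 t).const_mul (η / 2))).deriv]
        have := hule t (interior_subset ht)
        simp
        linarith
  have hend := hg2 (a := 0) (b := T₀ / 2) ⟨le_rfl, by linarith⟩ ⟨by linarith, le_rfl⟩ (by linarith)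
  have := hhalf (T₀ / 2) ⟨by linarith, le_rfl⟩
  simp only [hx0] at hend
  nlinarith

/-- Periodic motion in a symmetric well: the particle released at rest at `p` is at rest at `-p` at
time `σ` and again at rest at time `2 σ`. -/
lemma exists_oscillation (hf'c : Continuous f') {K : ℝ → ℝ≥0}
    (hlip : ∀ E, LipschitzWith (K E) (fun x => -(E ^ 2 * f' x / f x ^ 3)))
    {H : ℝ → ℝ} (hH : ∀ E x, |-(E ^ 2 * f' x / f x ^ 3)| ≤ H E)
    (heven : ∀ x, f (-x) = f x) {w p : ℝ} (hp : 0 < p) (hpw : p < w)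
    (hwell : ∀ x ∈ Ioo 0 w, 0 < f' x) :
    ∃ σ > 0, ∃ T > 2 * σ, ∃ x u : ℝ → ℝ, x 0 = p ∧ u 0 = 0 ∧
      (∀ t ∈ Icc 0 T, HasDerivWithinAt x (u t) (Icc 0 T) t) ∧
      (∀ t ∈ Icc 0 T, HasDerivWithinAt u (-(f p ^ 2 * f' (x t) / f (x t) ^ 3)) (Icc 0 T) t) ∧
      x σ = -p ∧ u σ = 0 ∧ u (2 * σ) = 0 := by
  obtain ⟨T₀, hT₀, hreach⟩ := exists_time_reaching_center hpos hf hf'c hp hpw hwell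
  have hodd : ∀ x, f' (-x) = -f' x := fun x => by
    have h1 : HasDerivAt (fun y => f (-y)) (f' (-x) * -1) x := (hf (-x)).comp x (hasDerivAt_neg x)
    rw [funext heven] at h1
    linarith [h1.unique (hf x)]
  obtain ⟨x, u, hx0, hu0, hx, hu⟩ := exists_newton (hlip (f p)) (hH (f p)) p
    (show 0 < 4 * T₀ + 1 by linarith)
  obtain ⟨τ, hτ, hxτ⟩ := hreach _ (by linarith) x u hx0 hu0 hx hu
  have hτ0 : 0 < τ := hτ.1.lt_of_ne fun h => by rw [← h, hx0] at hxτ; exact hp.ne' hxτ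
  have hτT := hτ.2
  have hinner : ∀ (r t : ℝ) (s : Set ℝ), HasDerivWithinAt (fun t => r - t) (-1) s t :=
    fun r t s => ((hasDerivAt_id' t).const_sub r).hasDerivWithinAt
  -- The force is odd, so `-x(2τ - t)` solves the same equation; it agrees with `x` to first order
  -- at `τ`, where `x = 0`. Hence the particle is at rest at `-p` at time `2τ`.
  have key1 := eq_of_newton (hlip (f p)) (x := x) (u := u) (y := fun t => -x (2 * τ - t))
    (w := fun t => u (2 * τ - t)) (a := τ) (b := 2 * τ)
    (fun t ht => (hx t ⟨by linarith [ht.1], by linarith [ht.2]⟩).mono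
      (Icc_subset_Icc hτ0.le (by linarith)))
    (fun t ht => (hu t ⟨by linarith [ht.1], by linarith [ht.2]⟩).mono
      (Icc_subset_Icc hτ0.le (by linarith)))
    (fun t ht => by
      have := ((hx (2 * τ - t) ⟨by linarith [ht.2], by linarith [ht.1]⟩).comp t
        (hinner (2 * τ) t (Icc τ (2 * τ)))
        fun r hr => ⟨by linarith [hr.2], by linarith [hr.1]⟩).fun_neg
      simpa [Function.comp_def] using this)
    (fun t ht => by
      have := (hu (2 * τ - t) ⟨by linarith [ht.2], by linarith [ht.1]⟩).comp t
        (hinner (2 * τ) t (Icc τ (2 * τ)))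
        fun r hr => ⟨by linarith [hr.2], by linarith [hr.1]⟩
      refine this.congr_deriv ?_
      rw [hodd, heven]; ring)
    (by simp [two_mul, hxτ]) (by simp [two_mul]) (2 * τ) ⟨by linarith, le_rfl⟩
  have hx2 : x (2 * τ) = -p := by simpa [hx0] using key1.1
  have hu2 : u (2 * τ) = 0 := by simpa [hu0] using key1.2
  -- Time reversal about the turning point `2τ` brings the particle back to rest at `4τ`.
  have key2 := eq_of_newton (hlip (f p)) (x := x) (u := u) (y := fun t => x (4 * τ - t))
    (w := fun t => -u (4 * τ - t)) (a := 2 * τ) (b := 4 * τ)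
    (fun t ht => (hx t ⟨by linarith [ht.1], by linarith [ht.2]⟩).mono
      (Icc_subset_Icc (by linarith) (by linarith)))
    (fun t ht => (hu t ⟨by linarith [ht.1], by linarith [ht.2]⟩).mono
      (Icc_subset_Icc (by linarith) (by linarith)))
    (fun t ht => by
      have := (hx (4 * τ - t) ⟨by linarith [ht.2], by linarith [ht.1]⟩).comp t
        (hinner (4 * τ) t (Icc (2 * τ) (4 * τ)))
        fun r hr => ⟨by linarith [hr.2], by linarith [hr.1]⟩
      simpa [Function.comp_def] using this)
    (fun t ht => by
      have := ((hu (4 * τ - t) ⟨by linarith [ht.2], by linarith [ht.1]⟩).comp t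
        (hinner (4 * τ) t (Icc (2 * τ) (4 * τ)))
        fun r hr => ⟨by linarith [hr.2], by linarith [hr.1]⟩).fun_neg
      refine this.congr_deriv ?_
      ring)
    (by ring_nf) (by rw [show 4 * τ - 2 * τ = 2 * τ by ring, hu2, neg_zero]) (4 * τ)
    ⟨by linarith, le_rfl⟩
  refine ⟨2 * τ, by linarith, 4 * T₀ + 1, by linarith, x, u, hx0, hu0, hx, hu, hx2, hu2, ?_⟩
  rw [show 2 * (2 * τ) = 4 * τ by ring, key2.2]
  simp [hu0]

end

section
variable {f f' f'' : ℝ → ℝ} (hpos : ∀ x, 0 < f x) (hf : ∀ x, HasDerivAt f (f' x) x)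
  (hf' : ∀ x, HasDerivAt f' (f'' x) x)

include hpos hf hf'

/-- Through every point of a symmetric well there is a timelike geodesic with conjugate points. -/
theorem exists_areConjugateOn_of_well {K : ℝ → ℝ≥0}
    (hlip : ∀ E, LipschitzWith (K E) (fun x => -(E ^ 2 * f' x / f x ^ 3)))
    {H : ℝ → ℝ} (hH : ∀ E x, |-(E ^ 2 * f' x / f x ^ 3)| ≤ H E)
    (heven : ∀ x, f (-x) = f x) {w : ℝ} (hwell : ∀ x ∈ Ioo 0 w, 0 < f' x)
    (q : Plane) (hq : |q 1| < w) :
    ∃ a > 0, ∃ c v : ℝ → Plane, c 0 = q ∧ IsGeodesicOn (warpedMetric f) (Ico 0 a) c v ∧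
      (∀ τ ∈ Ico 0 a, inner2 (warpedMetric f) (c τ) (v τ) (v τ) < 0) ∧
      ∃ s s', AreConjugateOn (warpedMetric f) (Ico 0 a) c v s s' := by
  have hfc : Continuous f := continuous_iff_continuousAt.2 fun x => (hf x).continuousAt
  have hf'c : Continuous f' := continuous_iff_continuousAt.2 fun x => (hf' x).continuousAt
  obtain ⟨p, hqp, hpw⟩ := exists_between hq
  have hp : 0 < p := (abs_nonneg _).trans_lt hqp
  have hfq : f (q 1) < f p := by
    have hmono : StrictMonoOn f (Ico 0 w) := by
      refine strictMonoOn_of_deriv_pos (convex_Ico 0 w) hfc.continuousOn fun y hy => ?_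
      rw [interior_Ico] at hy
      rw [(hf y).deriv]
      exact hwell y hy
    have : f (q 1) = f |q 1| := by rcases abs_choice (q 1) with h | h <;> rw [h]; rw [heven]
    rw [this]
    exact hmono ⟨abs_nonneg _, hq⟩ ⟨hp.le, hpw⟩ hqp
  obtain ⟨σ, hσ, T, hT, x, u, hx0, hu0, hx, hu, hxσ, huσ, hu2σ⟩ :=
    exists_oscillation hpos hf hf'c hlip hH heven hp hpw hwell
  set E := f p
  have hE : 0 < E := hpos p
  have hxc : ContinuousOn x (Icc 0 T) := fun t ht => (hx t ht).continuousWithinAt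
  have hen : ∀ t ∈ Icc 0 T, u t ^ 2 = E ^ 2 / f (x t) ^ 2 - 1 := fun t ht => by
    have := newton_energy hpos hf hx hu ht
    rw [hu0, hx0, div_self (by positivity)] at this
    linarith
  -- The geodesic is started at a time `r` when the oscillation passes the given point, so that both
  -- turning times `σ` and `2σ` lie ahead.
  obtain ⟨r, hr, hxr⟩ := intermediate_value_Icc' hσ.le
    (hxc.mono (Icc_subset_Icc_right (by linarith)))
    (show q 1 ∈ Icc (x σ) (x 0) by
      rw [hxσ, hx0]; exact ⟨(abs_lt.1 hqp).1.le, (abs_lt.1 hqp).2.le⟩)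
  obtain ⟨θ, hθ0, hθ⟩ := exists_antideriv_on_Icc (a := r) (b := T) (by linarith [hr.2])
    (g := fun t => E / f (x t) ^ 2)
    (continuousOn_const.div ((hfc.comp_continuousOn
      (hxc.mono (Icc_subset_Icc_left hr.1))).pow 2) fun t _ => pow_ne_zero _ (hpos _).ne') (q 0)
  have hshift : ∀ {g g' : ℝ → ℝ}, (∀ t ∈ Icc r T, HasDerivWithinAt g (g' t) (Icc r T) t) →
      ∀ τ ∈ Ico 0 (T - r), HasDerivWithinAt (fun t => g (r + t)) (g' (r + τ)) (Ico 0 (T - r)) τ := by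
    intro g g' hg τ hτ
    have hmap : ∀ t ∈ Ico 0 (T - r), r + t ∈ Icc r T :=
      fun t ht => ⟨by linarith [ht.1], by linarith [ht.2]⟩
    have := (hg (r + τ) (hmap τ hτ)).comp τ
      ((hasDerivAt_id' τ).const_add r).hasDerivWithinAt hmap
    simpa [Function.comp_def] using this
  have hsub : Icc r T ⊆ Icc 0 T := Icc_subset_Icc_left hr.1
  have hθ' := hshift hθ
  have hx' := hshift fun t ht => (hx t (hsub ht)).mono hsub
  have hu' := hshift fun t ht => (hu t (hsub ht)).mono hsub
  have hen' : ∀ τ ∈ Ico 0 (T - r), u (r + τ) ^ 2 = E ^ 2 / f (x (r + τ)) ^ 2 - 1 := fun τ hτ =>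
    hen _ ⟨by linarith [hτ.1, hr.1], by linarith [hτ.2]⟩
  have hrσ : r < σ := hr.2.lt_of_ne fun h => by
    rw [h, hxσ] at hxr
    linarith [(abs_lt.1 hqp).1]
  have hfx := fun τ hτ => (hf _).comp_hasDerivWithinAt τ (hx' τ hτ)
  have hfx' := fun τ hτ => (hf' _).comp_hasDerivWithinAt τ (hx' τ hτ)
  have hne : ∀ τ, f (x (r + τ)) ≠ 0 := fun τ => (hpos _).ne'
  set I := Ico 0 (T - r)
  set c : ℝ → Plane := fun t => ![θ (r + t), x (r + t)] with hc
  set v : ℝ → Plane := fun t => ![E / f (x (r + t)) ^ 2, u (r + t)] with hv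
  -- With `K = ∂_t`, `g(K, v) = -E` and `g(v, v) = -1`, this is the orthogonal part `K + g(K, v) v`.
  -- It vanishes where `v` is parallel to `K`, that is where `u = 0`. Its covariant derivative `W`
  -- is `∇_v K`, because `E` is constant and `∇_v v = 0`.
  set J : ℝ → Plane := fun t => ![1 - E ^ 2 / f (x (r + t)) ^ 2, -(E * u (r + t))] with hJ
  set W : ℝ → Plane := fun t => ![f' (x (r + t)) / f (x (r + t)) * u (r + t),
    E * f' (x (r + t)) / f (x (r + t))] with hW
  have hJ0 : ∀ t ∈ I, u (r + t) = 0 → J t = 0 := by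
    intro t ht h0
    have := hen' t ht
    rw [h0] at this
    ext i
    fin_cases i
    · simp [hJ]; linarith
    · simp [hJ, h0]
  have h0I : (0 : ℝ) ∈ I := ⟨le_rfl, by linarith⟩
  have h1I : σ - r ∈ I := ⟨by linarith, by linarith⟩
  have h2I : 2 * σ - r ∈ I := ⟨by linarith, by linarith⟩
  refine ⟨T - r, by linarith, c, v, ?_, ?_, ?_, σ - r, 2 * σ - r, h1I, h2I, by linarith, J, ?_,
    ⟨0, h0I, ?_⟩, hJ0 _ h1I (by simpa using huσ), hJ0 _ h2I (by simpa using hu2σ)⟩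
  · ext i
    fin_cases i <;> simp [hc, hθ0, hxr]
  · rw [isGeodesicOn_warpedMetric hpos hf]
    intro τ hτ
    refine ⟨hθ' τ hτ, hx' τ hτ, ?_, ?_⟩
    · refine ((hasDerivWithinAt_const τ I E).div ((hfx τ hτ).pow 2)
        (pow_ne_zero _ (hne τ))).congr_deriv ?_
      have := hne τ
      simp [hc, hv]
      field_simp
    · refine (hu' τ hτ).congr_deriv ?_
      have := hne τ
      simp [hc, hv]
      field_simp
  · intro τ hτ
    rw [inner2_warpedMetric]
    have h1 := hen' τ hτ
    have h2 : -f (c τ 1) ^ 2 * v τ 0 * v τ 0 + v τ 1 * v τ 1 = -1 := by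
      have := hne τ
      simp [hc, hv]
      rw [← sq (u (r + τ)), h1]
      field_simp
      ring
    linarith
  · rw [isJacobiFieldOn_warpedMetric hpos hf hf']
    refine ⟨W, fun τ hτ => ⟨?_, ?_, ?_, ?_⟩⟩
    · refine (((hasDerivWithinAt_const τ I (E ^ 2)).div ((hfx τ hτ).pow 2)
        (pow_ne_zero _ (hne τ))).const_sub 1).congr_deriv ?_
      have := hne τ
      simp [hc, hv, hJ, hW]
      field_simp
      ring
    · refine ((hu' τ hτ).const_mul E).neg.congr_deriv ?_
      have := hne τ
      simp [hc, hv, hJ, hW]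
      field_simp
      ring
    · refine (((hfx' τ hτ).div (hfx τ hτ) (hne τ)).mul (hu' τ hτ)).congr_deriv ?_
      have := hne τ
      simp [hc, hv, hJ, hW]
      field_simp
      ring
    · refine (((hfx' τ hτ).const_mul E).div (hfx τ hτ) (hne τ)).congr_deriv ?_
      have := hne τ
      simp [hc, hv, hJ, hW]
      field_simp
      ring
  -- `J ≠ 0` at the starting point because `|q 1| < p` was chosen strictly, so `f (q 1) < E`.
  · intro h
    have h0 := congrFun h 0
    have hfq' := hpos (q 1)
    simp [hJ, hxr] at h0
    have : E ^ 2 / f (q 1) ^ 2 = 1 := by linarith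
    rw [div_eq_one_iff_eq (by positivity)] at this
    nlinarith

end

end Lorentz

/-! ### The explicit well profile. -/

namespace Lorentz

lemma expNegInvGlue_le_one (x : ℝ) : expNegInvGlue x ≤ 1 := by
  rw [expNegInvGlue]
  split_ifs with h
  · exact zero_le_one
  · exact Real.exp_le_one_iff.2 (neg_nonpos.2 (inv_nonneg.2 (not_le.1 h).le))

lemma deriv_expNegInvGlue_pos {x : ℝ} (hx : 0 < x) : 0 < deriv expNegInvGlue x := by
  have h : expNegInvGlue =ᶠ[𝓝 x] fun y => Real.exp (-y⁻¹) := by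
    filter_upwards [lt_mem_nhds hx] with y hy
    rw [expNegInvGlue, if_neg (not_le.2 hy)]
  rw [h.deriv_eq, ((hasDerivAt_inv hx.ne').fun_neg.exp).deriv]
  have := Real.exp_pos (-x⁻¹)
  simp only [neg_neg]
  positivity

lemma deriv_expNegInvGlue_eq_zero {x : ℝ} (hx : x ≤ 0) : deriv expNegInvGlue x = 0 :=
  IsLocalMin.deriv_eq_zero (Filter.Eventually.of_forall fun y => by
    rw [expNegInvGlue.zero_of_nonpos hx]; exact expNegInvGlue.nonneg y)

/-- The first derivative is nonnegative by monotonicity and vanishes at `x`, so `x` is a minimum of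
it. -/
lemma deriv_deriv_expNegInvGlue_eq_zero {x : ℝ} (hx : x ≤ 0) :
    deriv (deriv expNegInvGlue) x = 0 :=
  IsLocalMin.deriv_eq_zero (Filter.Eventually.of_forall fun y => by
    rw [deriv_expNegInvGlue_eq_zero hx]; exact expNegInvGlue.monotone.deriv_nonneg)

/-- A smooth even `1`-periodic function which is `1` outside the wells `(n - w, n + w)`. -/
noncomputable def wellProfile (w x : ℝ) : ℝ :=
  -- The cosine makes the profile even and periodic; the factor `1 / 2` keeps it at least `1 / 2`.
  1 - expNegInvGlue (Real.cos (2 * Real.pi * x) - Real.cos (2 * Real.pi * w)) / 2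

/-- The derivative of `wellProfile`. -/
noncomputable def wellProfileDeriv (w x : ℝ) : ℝ :=
  deriv expNegInvGlue (Real.cos (2 * Real.pi * x) - Real.cos (2 * Real.pi * w)) *
    (Real.pi * Real.sin (2 * Real.pi * x))

section
variable (w : ℝ)

lemma contDiff_wellProfile : ContDiff ℝ ∞ (wellProfile w) := by
  have h : ContDiff ℝ ∞ expNegInvGlue := expNegInvGlue.contDiff
  unfold wellProfile
  fun_prop

lemma wellProfile_pos (x : ℝ) : 0 < wellProfile w x := by
  have := expNegInvGlue_le_one (Real.cos (2 * Real.pi * x) - Real.cos (2 * Real.pi * w))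
  rw [wellProfile]; linarith

lemma wellProfile_le_one (x : ℝ) : wellProfile w x ≤ 1 := by
  have := expNegInvGlue.nonneg (Real.cos (2 * Real.pi * x) - Real.cos (2 * Real.pi * w))
  rw [wellProfile]; linarith

lemma wellProfile_neg (x : ℝ) : wellProfile w (-x) = wellProfile w x := by
  simp [wellProfile]

lemma wellProfile_periodic : Function.Periodic (wellProfile w) 1 := fun x => by
  simp [wellProfile, mul_add]

lemma wellProfile_eq_one_iff {x : ℝ} :
    wellProfile w x = 1 ↔ Real.cos (2 * Real.pi * x) ≤ Real.cos (2 * Real.pi * w) := by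
  rw [← sub_nonpos, ← expNegInvGlue.zero_iff_nonpos, wellProfile]
  constructor <;> intro h <;> linarith

lemma hasDerivAt_wellProfile (x : ℝ) :
    HasDerivAt (wellProfile w) (wellProfileDeriv w x) x := by
  have hg : Differentiable ℝ expNegInvGlue :=
    (expNegInvGlue.contDiff (n := 1)).differentiable (by simp)
  have hlin : HasDerivAt (fun x => 2 * Real.pi * x) (2 * Real.pi) x := by
    simpa using (hasDerivAt_id' x).const_mul (2 * Real.pi)
  have := (((hg _).hasDerivAt.comp x
    (hlin.cos.sub_const (Real.cos (2 * Real.pi * w)))).div_const 2).const_sub 1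
  refine this.congr_deriv ?_
  rw [wellProfileDeriv]
  ring

lemma contDiff_wellProfileDeriv : ContDiff ℝ ∞ (wellProfileDeriv w) := by
  have : deriv (wellProfile w) = wellProfileDeriv w :=
    funext fun x => (hasDerivAt_wellProfile w x).deriv
  rw [← this]
  exact ((contDiff_succ_iff_deriv (n := ∞)).1 (contDiff_wellProfile w)).2.2

lemma wellProfileDeriv_periodic : Function.Periodic (wellProfileDeriv w) 1 := fun x => by
  simp [wellProfileDeriv, mul_add]

lemma deriv_wellProfileDeriv_eq_zero {x : ℝ} (hx : wellProfile w x = 1) :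
    deriv (wellProfileDeriv w) x = 0 := by
  rw [wellProfile_eq_one_iff, ← sub_nonpos] at hx
  have hg : Differentiable ℝ (deriv expNegInvGlue) :=
    ((contDiff_succ_iff_deriv (n := 1)).1 (expNegInvGlue.contDiff (n := 2))).2.2.differentiable
      (by simp)
  have hlin : HasDerivAt (fun x => 2 * Real.pi * x) (2 * Real.pi) x := by
    simpa using (hasDerivAt_id' x).const_mul (2 * Real.pi)
  have := ((hg _).hasDerivAt.comp x
    (hlin.cos.sub_const (Real.cos (2 * Real.pi * w)))).mul (hlin.sin.const_mul Real.pi)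
  refine HasDerivAt.deriv (this.congr_deriv ?_)
  simp [deriv_expNegInvGlue_eq_zero hx, deriv_deriv_expNegInvGlue_eq_zero hx]

variable {w}

lemma wellProfileDeriv_pos (hw : w < 1 / 2) {x : ℝ} (hx : x ∈ Ioo 0 w) :
    0 < wellProfileDeriv w x := by
  have hpi := Real.pi_pos
  refine mul_pos (deriv_expNegInvGlue_pos (sub_pos.2 ?_)) (mul_pos hpi ?_)
  · refine Real.cos_lt_cos_of_nonneg_of_le_pi ?_ ?_ ?_ <;> nlinarith [hx.1, hx.2]
  · refine Real.sin_pos_of_pos_of_lt_pi ?_ ?_ <;> nlinarith [hx.1, hx.2]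

/-- Cosine is decreasing on `[0, π]`, and `2π |x - round x|` lies in that interval. -/
lemma abs_sub_round_lt_of_wellProfile_ne_one (hw0 : 0 < w) (hw : w < 1 / 2) {x : ℝ}
    (hx : wellProfile w x ≠ 1) : |x - round x| < w := by
  have hpi := Real.pi_pos
  rw [Ne, wellProfile_eq_one_iff, not_le] at hx
  have h1 : Real.cos (2 * Real.pi * |x - round x|) = Real.cos (2 * Real.pi * x) := by
    have : 2 * Real.pi * |x - round x| = |2 * Real.pi * x - (round x : ℤ) * (2 * Real.pi)| := by
      rw [show 2 * Real.pi * x - (round x : ℤ) * (2 * Real.pi)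
        = 2 * Real.pi * (x - round x) by ring, abs_mul, abs_of_pos (by positivity : 0 < 2 * Real.pi)]
    rw [this, Real.cos_abs, Real.cos_sub_int_mul_two_pi]
  by_contra! hle
  have h2 := abs_sub_round x
  have := Real.cos_le_cos_of_nonneg_of_le_pi (x := 2 * Real.pi * w)
    (y := 2 * Real.pi * |x - round x|) (by positivity) (by nlinarith) (by gcongr)
  linarith

end

/-- A periodic `C¹` function is bounded and Lipschitz. -/
lemma exists_bound_and_lipschitz {g : ℝ → ℝ} (hg : ContDiff ℝ 1 g) (hper : Function.Periodic g 1) :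
    (∃ C, ∀ x, |g x| ≤ C) ∧ ∃ K, LipschitzWith K g := by
  have hb : ∀ {g : ℝ → ℝ}, Continuous g → Function.Periodic g 1 → ∃ C, ∀ x, |g x| ≤ C := by
    intro g hc hp
    obtain ⟨C, hC⟩ := (hp.isBounded_of_continuous one_ne_zero hc).exists_norm_le
    exact ⟨C, fun x => hC _ ⟨x, rfl⟩⟩
  refine ⟨hb hg.continuous hper, ?_⟩
  have hper' : Function.Periodic (deriv g) 1 := fun x => by
    rw [← deriv_comp_add_const, funext hper]
  obtain ⟨C, hC⟩ := hb (hg.continuous_deriv le_rfl) hper'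
  refine ⟨C.toNNReal, lipschitzWith_of_nnnorm_deriv_le (hg.differentiable (by simp)) fun x => ?_⟩
  rw [← NNReal.coe_le_coe, Real.coe_toNNReal _ ((abs_nonneg _).trans (hC 0))]
  exact hC x

/-- Periodicity makes the Newton force globally bounded and Lipschitz, as the existence and
uniqueness lemmas require for each energy `E`. -/
lemma wellProfile_force_bounds (w E : ℝ) :
    (∃ C, ∀ x, |-(E ^ 2 * wellProfileDeriv w x / wellProfile w x ^ 3)| ≤ C) ∧
      ∃ K, LipschitzWith K (fun x => -(E ^ 2 * wellProfileDeriv w x / wellProfile w x ^ 3)) := by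
  refine exists_bound_and_lipschitz ?_ fun x => ?_
  · have h1 := (contDiff_wellProfile w).of_le (show (1 : WithTop ℕ∞) ≤ ∞ by simp)
    have h2 := (contDiff_wellProfileDeriv w).of_le (show (1 : WithTop ℕ∞) ≤ ∞ by simp)
    exact ((contDiff_const.mul h2).div (h1.pow 3)
      fun x => pow_ne_zero _ (wellProfile_pos w x).ne').neg
  · simp only [wellProfile_periodic w x, wellProfileDeriv_periodic w x]

instance isProbabilityMeasure_unitAddCircle :
    IsProbabilityMeasure (volume : Measure UnitAddCircle) :=
  ⟨by rw [AddCircle.measure_univ, ENNReal.ofReal_one]⟩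

lemma proj_surjective : Function.Surjective proj := fun q => by
  choose p hp using fun i => QuotientAddGroup.mk_surjective (q i)
  exact ⟨p, funext hp⟩

end Lorentz

/-! ### The quotient torus, total viciousness and class A. -/

open Lorentz

/-- The quotient of the plane with the metric `-f(x)² dt² + dx²`, for a periodic function `f`. -/
noncomputable def warpedTorus (f : ℝ → ℝ) (hfs : ContDiff ℝ ∞ f) (hpos : ∀ x, 0 < f x)
    (hper : Function.Periodic f 1) : LorentzianTorus where
  metric q := !![-(hper.lift (q 1)) ^ 2, 0; 0, 1]
  timeField _ := ![1, 0]
  metric_smooth i j := by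
    have h : ∀ p : Plane, hper.lift (proj p 1) = f (p 1) := fun p => hper.lift_coe (p 1)
    fin_cases i <;> fin_cases j <;> simp [h] <;> fun_prop
  metric_symm q := by
    ext i j
    fin_cases i <;> fin_cases j <;> simp
  metric_lorentzian q := by
    obtain ⟨p, rfl⟩ := proj_surjective q
    have h : hper.lift (proj p 1) = f (p 1) := hper.lift_coe (p 1)
    have := hpos (p 1)
    rw [h, Matrix.det_fin_two_of]
    simp
    positivity
  timeField_smooth := contDiff_const
  timeField_timelike q := by
    obtain ⟨p, rfl⟩ := proj_surjective q
    have h : hper.lift (proj p 1) = f (p 1) := hper.lift_coe (p 1)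
    have := hpos (p 1)
    rw [h]
    simp [Matrix.mulVec, dotProduct, Fin.sum_univ_two]
    positivity

namespace LorentzianTorus

section
variable {f : ℝ → ℝ} (hfs : ContDiff ℝ ∞ f) (hpos : ∀ x, 0 < f x) (hper : Function.Periodic f 1)

lemma coverMetric_warpedTorus : (warpedTorus f hfs hpos hper).coverMetric = warpedMetric f := by
  funext p
  have h : hper.lift (proj p 1) = f (p 1) := hper.lift_coe (p 1)
  simp [coverMetric, warpedTorus, warpedMetric, h]

/-- The circle in the `t`-direction through a point is a timelike loop. -/
lemma totallyVicious_warpedTorus : (warpedTorus f hfs hpos hper).TotallyVicious := by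
  intro q
  obtain ⟨p, rfl⟩ := proj_surjective q
  have hc : ∀ s : ℝ, HasDerivAt (fun s : ℝ => (![p 0 + s, p 1] : Plane)) ![1, 0] s := fun s => by
    rw [hasDerivAt_pi, Fin.forall_fin_two]
    constructor
    · simpa using (hasDerivAt_id' s).const_add (p 0)
    · simpa using hasDerivAt_const s (p 1)
  refine Relation.TransGen.single ⟨p, ![p 0 + 1, p 1], rfl, ?_, fun s => ![p 0 + s, p 1],
    ?_, ?_, rfl, fun s hs => ?_⟩
  · funext i
    fin_cases i
    · exact AddCircle.coe_add_period 1 (p 0)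
    · rfl
  · refine ContDiff.contDiffOn (contDiff_pi.2 (Fin.forall_fin_two.2 ⟨?_, ?_⟩))
    · simp only [Matrix.cons_val_zero]; fun_prop
    · simp only [Matrix.cons_val_one]; fun_prop
  · ext i; fin_cases i <;> simp
  · rw [(hc s).hasDerivWithinAt.derivWithin (uniqueDiffOn_Icc zero_lt_one s hs),
      coverMetric_warpedTorus]
    have := hpos (p 1)
    constructor <;> rw [inner2_warpedMetric] <;>
      simp [coverTimeField, warpedTorus] <;> positivity

lemma isClassA_warpedTorus (hle : ∀ x, f x ≤ 1) : (warpedTorus f hfs hpos hper).IsClassA := by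
  refine ⟨totallyVicious_warpedTorus hfs hpos hper, ?_⟩
  obtain ⟨F, hFs, hF, hexp⟩ := exists_conformal_coordinate hfs hpos hle
  rw [coverMetric_warpedTorus]
  exact globallyHyperbolic_of_conformal hpos hF hFs hexp

lemma vol_warpedTorus (S : Set Torus) (hS : MeasurableSet S) :
    (warpedTorus f hfs hpos hper).vol S = ∫⁻ q in S, ENNReal.ofReal (hper.lift (q 1)) := by
  rw [vol, withDensity_apply _ hS]
  congr 1
  funext q
  obtain ⟨p, rfl⟩ := proj_surjective q
  have h : hper.lift (proj p 1) = f (p 1) := hper.lift_coe (p 1)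
  congr 1
  simp [warpedTorus, h, Matrix.det_fin_two_of, Real.sqrt_sq (hpos (p 1)).le]

end

/-! ### The well torus: non-flatness, its poles and their measure. -/

section
variable {w : ℝ} (hw0 : 0 < w) (hw : w < 1 / 2)

/-- The torus whose warping function is `wellProfile w`. -/
noncomputable abbrev wellTorus (w : ℝ) : LorentzianTorus :=
  warpedTorus (wellProfile w) (contDiff_wellProfile w) (wellProfile_pos w) (wellProfile_periodic w)

lemma hasDerivAt_wellProfileDeriv (w x : ℝ) :
    HasDerivAt (wellProfileDeriv w) (deriv (wellProfileDeriv w) x) x :=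
  ((contDiff_wellProfileDeriv w).differentiable (by simp) x).hasDerivAt

lemma measurable_lift_wellProfile (w : ℝ) : Measurable (wellProfile_periodic w).lift := by
  refine Continuous.measurable ?_
  exact continuous_quot_lift _ (contDiff_wellProfile w).continuous

include hw0 hw

/-- Flatness would give `f'' = 0`, hence a constant `f'`; but `f'` vanishes at `0` and is positive
at `w / 2`. -/
lemma not_isFlat_wellTorus : ¬ (wellTorus w).IsFlat := by
  intro h
  have h2 : ∀ x, deriv (wellProfileDeriv w) x = 0 := fun x => by
    have := h 1 0 1 0 ![0, x]
    rw [coverMetric_warpedTorus, riemann_warpedMetric (wellProfile_pos w)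
      (hasDerivAt_wellProfile w) (hasDerivAt_wellProfileDeriv w)] at this
    simpa [(wellProfile_pos w x).ne'] using this
  have h3 := is_const_of_deriv_eq_zero
    ((contDiff_wellProfileDeriv w).differentiable (by simp)) h2 (w / 2) 0
  have h4 := wellProfileDeriv_pos hw (x := w / 2) ⟨by linarith, by linarith⟩
  rw [h3] at h4
  simp [wellProfileDeriv] at h4

lemma exists_small_lift {y : UnitAddCircle} (hy : (wellProfile_periodic w).lift y ≠ 1) :
    ∃ z : ℝ, (z : UnitAddCircle) = y ∧ |z| < w := by
  obtain ⟨x, rfl⟩ := QuotientAddGroup.mk_surjective y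
  refine ⟨x - round x, ?_, abs_sub_round_lt_of_wellProfile_ne_one hw0 hw hy⟩
  rw [AddCircle.coe_sub, sub_eq_self, AddCircle.coe_eq_zero_iff]
  exact ⟨round x, by simp⟩

/-- A point with `f ≠ 1` has a lift in the well around `0`, where the oscillating geodesic lives.
Where `f = 1`, the profile is maximal and its second derivative vanishes. -/
lemma timelikePoles_wellTorus :
    (wellTorus w).timelikePoles = {q | (wellProfile_periodic w).lift (q 1) = 1} := by
  choose C hC using fun E => (wellProfile_force_bounds w E).1
  choose K hK using fun E => (wellProfile_force_bounds w E).2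
  ext q
  simp only [timelikePoles, coverMetric_warpedTorus, mem_ofPred_eq]
  constructor
  · intro hq
    by_contra hne
    obtain ⟨z, hz, hzw⟩ := exists_small_lift hw0 hw hne
    obtain ⟨p, rfl⟩ := proj_surjective q
    obtain ⟨a, ha, c, v, hc, hgeo, htl, s, s', hconj⟩ :=
      exists_areConjugateOn_of_well (wellProfile_pos w) (hasDerivAt_wellProfile w)
        (hasDerivAt_wellProfileDeriv w) hK hC (wellProfile_neg w)
        (fun x hx => wellProfileDeriv_pos hw hx) ![p 0, z] hzw
    refine hq a ha c v ?_ hgeo htl s s' hconj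
    rw [hc]
    funext i
    fin_cases i
    · rfl
    · exact hz
  · rintro hq a ha c v rfl hgeo htl s s'
    have hq' : wellProfile w (c 0 1) = 1 := hq
    exact not_areConjugateOn_of_max (wellProfile_pos w) (hasDerivAt_wellProfile w)
      (hasDerivAt_wellProfileDeriv w) hK hgeo htl
      (fun x => by rw [hq']; exact wellProfile_le_one w x)
      (deriv_wellProfileDeriv_eq_zero w hq') s s'

/-- The complement projects into an arc of radius `w`, of length at most `2 w`. -/
lemma le_volume_timelikePoles :
    ENNReal.ofReal (1 - 2 * w) ≤ volume {q : Torus | (wellProfile_periodic w).lift (q 1) = 1} := by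
  set S : Set UnitAddCircle := {y | (wellProfile_periodic w).lift y = 1} with hS
  have hSm : MeasurableSet S := measurable_lift_wellProfile w (measurableSet_singleton 1)
  have h1 : volume {q : Torus | (wellProfile_periodic w).lift (q 1) = 1} = volume S :=
    (measurePreserving_eval (fun _ : Fin 2 => (volume : Measure UnitAddCircle)) 1).measure_preimage
      hSm.nullMeasurableSet
  have h2 : Sᶜ ⊆ Metric.closedBall 0 w := by
    intro y hy
    obtain ⟨z, rfl, hz⟩ := exists_small_lift hw0 hw hy
    rw [mem_closedBall_zero_iff, UnitAddCircle.norm_eq]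
    have := round_le z 0
    simp at this
    linarith
  have h3 : volume Sᶜ ≤ ENNReal.ofReal (2 * w) := by
    refine (measure_mono h2).trans ?_
    rw [AddCircle.volume_closedBall]
    exact ENNReal.ofReal_le_ofReal (min_le_right _ _)
  have h4 := prob_add_prob_compl (μ := (volume : Measure UnitAddCircle)) hSm
  rw [h1, ENNReal.ofReal_sub _ (by linarith), ENNReal.ofReal_one, tsub_le_iff_right, ← h4]
  gcongr

end

end LorentzianTorus

open LorentzianTorus

theorem mainTheorem3 (ε : ℝ) (hε0 : 0 < ε) (hε1 : ε < 1) :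
    ∃ (M : LorentzianTorus) (f : ℝ → ℝ),
      ContDiff ℝ ∞ f ∧ (∀ x, 0 < f x) ∧ Function.Periodic f 1 ∧
      (∀ p : Lorentz.Plane, M.metric (Lorentz.proj p) = !![-(f (p 1)) ^ 2, 0; 0, 1]) ∧
      (∀ q : Lorentz.Torus, M.timeField q = ![1, 0]) ∧
      ¬ M.IsFlat ∧ M.IsClassA ∧
      MeasurableSet M.timelikePoles ∧
      ENNReal.ofReal (1 - ε) * M.vol Set.univ ≤ M.vol M.timelikePoles ∧
      M.vol M.timelikePoles ≤ M.vol Set.univ := by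
  -- The half-width `w = ε / 2` turns the bound `1 - 2 w` into `1 - ε`.
  have hw0 : 0 < ε / 2 := by linarith
  have hw : ε / 2 < 1 / 2 := by linarith
  have hpoles := timelikePoles_wellTorus hw0 hw
  have hmeas : MeasurableSet (wellTorus (ε / 2)).timelikePoles := by
    rw [hpoles]
    exact ((measurable_lift_wellProfile _).comp (measurable_pi_apply 1))
      (measurableSet_singleton 1)
  refine ⟨wellTorus (ε / 2), wellProfile (ε / 2), contDiff_wellProfile _, wellProfile_pos _,
    wellProfile_periodic _, fun p => rfl, fun _ => rfl, not_isFlat_wellTorus hw0 hw,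
    isClassA_warpedTorus _ _ _ (wellProfile_le_one _), hmeas, ?_, measure_mono (subset_univ _)⟩
  have huniv : (wellTorus (ε / 2)).vol univ ≤ 1 := by
    rw [vol_warpedTorus _ _ _ _ MeasurableSet.univ]
    calc ∫⁻ q : Torus in univ, ENNReal.ofReal ((wellProfile_periodic (ε / 2)).lift (q 1))
        ≤ ∫⁻ _ : Torus in univ, 1 := by
          refine lintegral_mono fun q => ?_
          obtain ⟨p, rfl⟩ := proj_surjective q
          exact ENNReal.ofReal_le_one.2 (wellProfile_le_one _ _)
      _ = 1 := by simp
  -- The volume density is `f`, which equals `1` on the poles and is at most `1` elsewhere, so both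
  -- sides of the estimate compare with Lebesgue measure.
  have hvol : (wellTorus (ε / 2)).vol (wellTorus (ε / 2)).timelikePoles
      = volume {q : Torus | (wellProfile_periodic (ε / 2)).lift (q 1) = 1} := by
    rw [vol_warpedTorus _ _ _ _ hmeas, setLIntegral_congr_fun (g := fun _ => 1) hmeas, hpoles]
    · simp
    · intro q hq
      rw [hpoles] at hq
      simp only [mem_ofPred_eq] at hq
      simp [hq]
  rw [hvol]
  calc ENNReal.ofReal (1 - ε) * (wellTorus (ε / 2)).vol univ
      ≤ ENNReal.ofReal (1 - ε) * 1 := by gcongr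
    _ ≤ _ := by
      rw [mul_one]
      convert le_volume_timelikePoles hw0 hw using 3
      ring
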